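/- **Setting.** Let $q$ be a complex-valued quadratic form on $\mathbf R^n_y\times\mathbf R^n_\eta$ with $\operatorname{Re} q$ positive definite, extended to a complex quadratic form on $\mathbf C^{2n}$, with polarization $q(X,Y)$. Let $\sigma((x,\xi),(y,\eta))=\xi\cdot y-x\cdot\eta$, let $F:\mathbf C^{2n}\to\mathbf C^{2n}$ be the Hamilton map of $q$, defined by $q(X,Y)=\sigma(X,FY)$, and let $\Lambda^{\pm}$ be the direct sum of the generalized eigenspaces of $F$ belonging to the eigenvalues $\lambda$ with $\pm\operatorname{Im}\lambda>0$. Let $S$ be a real linear canonical transformation, extended to $\mathbf C^{2n}$, such that $S(\Lambda^-)=\{\eta=-iy\}$, and write $S(\Lambda^+)=\{\eta=Ay\}$ with a complex $n\times n$ matrix $A$. Put $B=(1-iA)^{-1}A$, $$\kappa_T(y,\eta)=(y-i\eta,\ \eta+iB\eta-By),\qquad \kappa_C(x,\xi)=(C^{-1}x,\ C^{t}\xi),$$ where $C$ is an invertible complex $n\times n$ matrix, and $$\widetilde q=q\circ S^{-1}\circ\kappa_T^{-1}\circ\kappa_C^{-1},\qquad \Phi_0(x)=\tfrac12\big((\operatorname{Im}x)^2+\operatorname{Im}(Bx\cdot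 x)\big),\qquad \Phi_1(x)=\Phi_0(Cx),\quad x\in\mathbf C^n.$$ (Then $\widetilde q(x,\xi)=Mx\cdot\xi$ for some complex $n\times n$ matrix $M$; a suitable choice of $C$ brings $M$ to Jordan normal form.) For $h>0$ let $L^2_{\Phi_1}=L^2(\mathbf C^n;e^{-2\Phi_1/h}L(dx))$, where $L(dx)$ is Lebesgue measure, and let $H_{\Phi_1}$ be the space of entire functions in $L^2_{\Phi_1}$, with the same norm. Let $\widetilde q^w=\widetilde q^w(x,hD_x)$, $hD_x=\frac hi\partial_x$, be the semiclassical Weyl quantization of $\widetilde q$, acting on entire functions. **Proposition.** Let $K>0$, let $C_1\ge1$ be such that $\Phi_1(x)\le C_1|x|^2$ for all $x\in\mathbf C^n$, and let $C_0>1$ be such that $$\operatorname{Re}\widetilde q\Big(x,\frac2i\frac{\partial\Phi_1}{\partial x}(x)\Big)\ge\frac{|x|^2}{C_0},\qquad x\in\mathbf C^n.$$ There exist constants $c>0$ and $h_0>0$ (independent of $h$, $z$ and $u$ below) such that the following holds for all $h\in(0,h_0]$ and all $z\in\mathbf C$ with $|z|\le K^2/(8C_0)$. Let $N_0$ be the least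 natural number such that $$N_0\ge\frac{2C_1(K+1)^2e^2+1}{h}.$$ If $u\in H_{\Phi_1}$ satisfies $(1+|x|^2)u\in L^2_{\Phi_1}$ and $\partial^\alpha u(0)=0$ for all $|\alpha|<N_0$, then $(\widetilde q^w-z)u\in H_{\Phi_1}$ and $$\|u\|_{H_{\Phi_1}}\le c\,\|(\widetilde q^w-z)u\|_{H_{\Phi_1}}.$$ -/

import Mathlib

open MeasureTheory
open scoped Matrix

namespace QuadBargmann

noncomputable section

/-! ### Phase space, quadratic forms and the Hamilton map -/

/-- The complex phase space of points `(x, ξ)` with `x, ξ ∈ ℂⁿ`. -/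
abbrev Phase (n : ℕ) : Type := (Fin n → ℂ) × (Fin n → ℂ)

/-- The square of the Euclidean norm, `|x|² = ∑ⱼ |xⱼ|²`. -/
def normSq {n : ℕ} (x : Fin n → ℂ) : ℝ := ∑ j, ‖x j‖ ^ 2

/-- The standard basis vector `∂/∂xⱼ` of phase space. -/
def ex {n : ℕ} (j : Fin n) : Phase n := (Pi.single j 1, 0)

/-- The standard basis vector `∂/∂ξⱼ` of phase space. -/
def eξ {n : ℕ} (j : Fin n) : Phase n := (0, Pi.single j 1)

/-- The complex symplectic form `σ((x, ξ), (y, η)) = ξ · y - x · η`. -/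
def sympl {n : ℕ} (X Y : Phase n) : ℂ := X.2 ⬝ᵥ Y.1 - X.1 ⬝ᵥ Y.2

/-- The polarization `q(X, Y)` of a quadratic form: the symmetric bilinear form with
`q(X, X) = q(X)`. -/
def polarization {n : ℕ} (q : QuadraticForm ℂ (Phase n)) :
    LinearMap.BilinForm ℂ (Phase n) :=
  QuadraticMap.associated q

/-- `Re q` is positive definite on the real phase space `ℝⁿ × ℝⁿ`. A complex valued quadratic form
on `ℝ²ⁿ` is identified with its unique extension to a complex quadratic form on `ℂ²ⁿ`. -/
def RePosDef {n : ℕ} (q : QuadraticForm ℂ (Phase n)) : Prop :=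
  ∀ y η : Fin n → ℝ, (y, η) ≠ 0 → 0 < (q (fun j => (y j : ℂ), fun j => (η j : ℂ))).re

/-- The Hamilton map `F = ½ H_q`, where `H_q = q'_ξ · ∂_x - q'_x · ∂_ξ`. -/
def hamiltonMap {n : ℕ} (q : QuadraticForm ℂ (Phase n)) : Module.End ℂ (Phase n) where
  toFun Y := (fun j => polarization q (eξ j) Y, fun j => -polarization q (ex j) Y)
  map_add' Y Z := by
    ext j <;> simp
    ring
  map_smul' c Y := by
    ext j <;> simp

/-- The defining identity `q(X, Y) = σ(X, F Y)` of the Hamilton map. -/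
theorem polarization_eq_sympl_hamiltonMap {n : ℕ} (q : QuadraticForm ℂ (Phase n))
    (X Y : Phase n) : polarization q X Y = sympl X (hamiltonMap q Y) := by
  have hX : X = ∑ j, (X.1 j • ex j + X.2 j • eξ j) := by
    ext i
    · simp [ex, eξ, Prod.fst_sum, Finset.sum_apply, Pi.single_apply]
    · simp [ex, eξ, Prod.snd_sum, Finset.sum_apply, Pi.single_apply]
  conv_lhs => rw [hX]
  simp only [map_sum, map_add, map_smul, LinearMap.add_apply, LinearMap.smul_apply,
    LinearMap.coe_sum, Finset.sum_apply, smul_eq_mul, sympl, hamiltonMap, dotProduct,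
    LinearMap.coe_mk, AddHom.coe_mk]
  rw [← Finset.sum_sub_distrib]
  exact Finset.sum_congr rfl fun j _ => by ring

/-- `Λ⁺`, the sum of the generalized eigenspaces of `F` for the eigenvalues with `Im λ > 0`. -/
def lambdaPlus {n : ℕ} (q : QuadraticForm ℂ (Phase n)) : Submodule ℂ (Phase n) :=
  ⨆ l : ℂ, ⨆ _ : 0 < l.im, (hamiltonMap q).maxGenEigenspace l

/-- `Λ⁻`, the sum of the generalized eigenspaces of `F` for the eigenvalues with `Im λ < 0`. -/
def lambdaMinus {n : ℕ} (q : QuadraticForm ℂ (Phase n)) : Submodule ℂ (Phase n) :=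
  ⨆ l : ℂ, ⨆ _ : l.im < 0, (hamiltonMap q).maxGenEigenspace l

/-! ### The reduction to a Bargmann space -/

/-- `S` is a real linear canonical transformation (extended to the complexification). -/
def IsRealCanonical {n : ℕ} (S : Phase n ≃ₗ[ℂ] Phase n) : Prop :=
  (∀ X Y, sympl (S X) (S Y) = sympl X Y) ∧ ∀ X, S (star X) = star (S X)

/-- The matrix `B = (1 - iA)⁻¹ A`. -/
def matB {n : ℕ} (A : Matrix (Fin n) (Fin n) ℂ) : Matrix (Fin n) (Fin n) ℂ :=
  (1 - Complex.I • A)⁻¹ * A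

/-- The canonical transformation `(y, η) ↦ (y - iη, η + iBη - By)` of the FBI-Bargmann transform
with phase `φ(x, y) = (i/2)(x - y)² - ½ Bx·x`, that is, `(y, -φ'_y) ↦ (x, φ'_x)`. -/
def kappaT {n : ℕ} (B : Matrix (Fin n) (Fin n) ℂ) : Phase n ≃ₗ[ℂ] Phase n where
  toFun X := (X.1 - Complex.I • X.2, X.2 + Complex.I • (B *ᵥ X.2) - B *ᵥ X.1)
  invFun X := (X.1 + Complex.I • (X.2 + B *ᵥ X.1), X.2 + B *ᵥ X.1)
  map_add' X Y := by
    refine Prod.ext ?_ ?_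
    · simp only [Prod.fst_add, Prod.snd_add, smul_add]
      abel
    · simp only [Prod.fst_add, Prod.snd_add, smul_add, Matrix.mulVec_add]
      abel
  map_smul' c X := by
    refine Prod.ext ?_ ?_
    · simp only [Prod.smul_fst, Prod.smul_snd, RingHom.id_apply, smul_sub, smul_comm c]
    · simp only [Prod.smul_fst, Prod.smul_snd, RingHom.id_apply, Matrix.mulVec_smul, smul_sub,
        smul_add, smul_comm c]
  left_inv X := by
    refine Prod.ext ?_ ?_ <;> simp [Matrix.mulVec_sub, Matrix.mulVec_smul]
  right_inv X := by
    refine Prod.ext ?_ ?_ <;> simp [Matrix.mulVec_add, Matrix.mulVec_smul]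

/-- The canonical transformation `(x, ξ) ↦ (C⁻¹ x, Cᵗ ξ)`. -/
def kappaC {n : ℕ} (C : GL (Fin n) ℂ) : Phase n ≃ₗ[ℂ] Phase n where
  toFun X := (((C⁻¹ : GL (Fin n) ℂ) : Matrix (Fin n) (Fin n) ℂ) *ᵥ X.1,
    (C : Matrix (Fin n) (Fin n) ℂ)ᵀ *ᵥ X.2)
  invFun X := ((C : Matrix (Fin n) (Fin n) ℂ) *ᵥ X.1,
    ((C⁻¹ : GL (Fin n) ℂ) : Matrix (Fin n) (Fin n) ℂ)ᵀ *ᵥ X.2)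
  map_add' X Y := by simp [Matrix.mulVec_add]
  map_smul' c X := by simp [Matrix.mulVec_smul]
  left_inv X := by
    refine Prod.ext ?_ ?_
    · simp only [Matrix.mulVec_mulVec, Units.mul_inv, Matrix.one_mulVec]
    · simp only [Matrix.mulVec_mulVec, ← Matrix.transpose_mul, Units.mul_inv,
        Matrix.transpose_one, Matrix.one_mulVec]
  right_inv X := by
    refine Prod.ext ?_ ?_
    · simp only [Matrix.mulVec_mulVec, Units.inv_mul, Matrix.one_mulVec]
    · simp only [Matrix.mulVec_mulVec, ← Matrix.transpose_mul, Units.inv_mul,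
        Matrix.transpose_one, Matrix.one_mulVec]

/-- The reduced symbol `q̃ = q ∘ S⁻¹ ∘ κ_T⁻¹ ∘ κ_C⁻¹`, with `κ_T` built from `B = (1 - iA)⁻¹ A`. -/
def qTilde {n : ℕ} (q : QuadraticForm ℂ (Phase n)) (S : Phase n ≃ₗ[ℂ] Phase n)
    (A : Matrix (Fin n) (Fin n) ℂ) (C : GL (Fin n) ℂ) : QuadraticForm ℂ (Phase n) :=
  q.comp ((S.trans ((kappaT (matB A)).trans (kappaC C))).symm : Phase n →ₗ[ℂ] Phase n)

/-- The weight `Φ₀(x) = ½ ((Im x)² + Im (Bx·x))`, with `B = (1 - iA)⁻¹ A`. -/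
def Phi0 {n : ℕ} (A : Matrix (Fin n) (Fin n) ℂ) (x : Fin n → ℂ) : ℝ :=
  (1 / 2) * (∑ j, (x j).im ^ 2 + ((matB A *ᵥ x) ⬝ᵥ x).im)

/-- The weight `Φ₁(x) = Φ₀(Cx)`. -/
def Phi1 {n : ℕ} (A : Matrix (Fin n) (Fin n) ℂ) (C : GL (Fin n) ℂ) (x : Fin n → ℂ) : ℝ :=
  Phi0 A ((C : Matrix (Fin n) (Fin n) ℂ) *ᵥ x)

/-- The holomorphic gradient `∂Φ/∂x`, with components `½ (∂/∂(Re xⱼ) - i ∂/∂(Im xⱼ)) Φ`. -/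
def holGrad {n : ℕ} (Φ : (Fin n → ℂ) → ℝ) (x : Fin n → ℂ) : Fin n → ℂ := fun j =>
  (1 / 2) * (((fderiv ℝ Φ x (Pi.single j 1) : ℝ) : ℂ)
    - Complex.I * ((fderiv ℝ Φ x (Pi.single j Complex.I) : ℝ) : ℂ))

/-! ### Bargmann spaces and Weyl quantization -/

/-- The measure `e^{-2Φ/h} L(dx)` on `ℂⁿ`, with `L(dx)` the Lebesgue measure. -/
def weightMeasure {n : ℕ} (h : ℝ) (Φ : (Fin n → ℂ) → ℝ) : Measure (Fin n → ℂ) :=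
  volume.withDensity fun x => ENNReal.ofReal (Real.exp (-2 * Φ x / h))

/-- Membership in `L²_Φ = L²(ℂⁿ; e^{-2Φ/h} L(dx))`. -/
def MemL2 {n : ℕ} (h : ℝ) (Φ : (Fin n → ℂ) → ℝ) (u : (Fin n → ℂ) → ℂ) : Prop :=
  MemLp u 2 (weightMeasure h Φ)

/-- Membership in `H_Φ = Hol(ℂⁿ) ∩ L²_Φ`. -/
def MemH {n : ℕ} (h : ℝ) (Φ : (Fin n → ℂ) → ℝ) (u : (Fin n → ℂ) → ℂ) : Prop :=
  Differentiable ℂ u ∧ MemL2 h Φ u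

/-- The norm of `H_Φ`, `(∫ |u|² e^{-2Φ/h} L(dx))^{1/2}`. -/
def normH {n : ℕ} (h : ℝ) (Φ : (Fin n → ℂ) → ℝ) (u : (Fin n → ℂ) → ℂ) : ℝ :=
  (eLpNorm u 2 (weightMeasure h Φ)).toReal

/-- `hD_{xⱼ} = (h/i) ∂_{xⱼ}`, acting on holomorphic functions. -/
def hD {n : ℕ} (h : ℝ) (j : Fin n) (u : (Fin n → ℂ) → ℂ) (x : Fin n → ℂ) : ℂ :=
  ((h : ℂ) / Complex.I) * fderiv ℂ u x (Pi.single j 1)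

/-- The semiclassical Weyl quantization `Q^w(x, hD_x)` of a quadratic symbol, acting on holomorphic
functions: `xⱼ xₖ`, `2 xⱼ ξₖ`, `ξⱼ ξₖ` are quantized as `xⱼ xₖ`, `xⱼ ∘ hDₖ + hDₖ ∘ xⱼ`,
`hDⱼ ∘ hDₖ` respectively. -/
def weyl {n : ℕ} (h : ℝ) (Q : QuadraticForm ℂ (Phase n)) (u : (Fin n → ℂ) → ℂ)
    (x : Fin n → ℂ) : ℂ :=
  ∑ j, ∑ k,
    (polarization Q (ex j) (ex k) * (x j * x k * u x)
      + polarization Q (ex j) (eξ k) * (x j * hD h k u x + hD h k (fun y => y j * u y) x)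
      + polarization Q (eξ j) (eξ k) * hD h j (hD h k u) x)

/-- All partial derivatives `∂_{s₁} ⋯ ∂_{sₖ} u` of order `k < N` vanish at the origin. -/
def VanishesToOrder {n : ℕ} (N : ℕ) (u : (Fin n → ℂ) → ℂ) : Prop :=
  ∀ k < N, ∀ s : Fin k → Fin n,
    iteratedFDeriv ℂ k u 0 (fun i => (Pi.single (s i) 1 : Fin n → ℂ)) = 0

end

end QuadBargmann

open QuadBargmann

/-! The argument has an algebraic and an analytic half.

Generalized eigenspaces of the Hamilton map `F` for eigenvalues `λ`, `μ` with `λ + μ ≠ 0` are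
orthogonal for the polarization of `q`, since `F` is skew for it; hence `q` vanishes on `Λ⁺` and on
`Λ⁻`. The reduction sends `Λ⁻` to `x = 0` and `Λ⁺` to `ξ = 0`, so `q̃(x, ξ) = Mx · ξ`
(`qTilde_zero_left`, `qTilde_zero_right`, `apply_eq_sum_of_vanishing`), and `q̃ʷ` is the first order
operator `Mx · hD + (h / 2i) tr M` (`weyl_eq_of_vanishing`).

For holomorphic `u` the factor `conj u` is antiholomorphic, so an integration by parts gives exactly
`(q̃ʷ u, u) = ∫ (q̃(x, (2/i) ∂Φ₁) - (h / 2i) tr M) |u|² e^{-2Φ₁/h}` (`integral_weyl_mul_conj`). By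
ellipticity the real part of `((q̃ʷ - z) u, u)` is therefore at least
`∫ (|x|² / C₀ - |z| - O(h)) |u|² e^{-2Φ₁/h}`, and the estimate follows once at most half of the mass
of `u` lies in `|x| ≤ K` (`normH_le_of_elliptic`). The integrations by parts are legitimate because
in a quadratic weight `x_j ∂ₖ u` is square integrable as soon as `(1 + |x|²) u` is
(`integrable_norm_fderiv_sq`).

The mass in `|x| ≤ K` is small because `u` vanishes to order `N₀` at `0`. With `R = (K + 1) e`, a
Schwarz lemma in the mean on complex lines (`setIntegral_norm_sq_le_of_vanishing`) bounds `∫ |u|²`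
over `|x| ≤ K` by `2 (K / R)^{2 N₀} ≤ 2 e^{-2 N₀}` times that over `|x| ≤ R`. Passing to the weighted
integrals costs at most `e^{2 C₁ (K² + R²) / h}`, because `|Φ₁| ≤ C₁ |x|²`: the lower bound comes
from the upper one, as `Φ₁(x) + Φ₁(ix) ≥ 0` by plurisubharmonicity. The choice of `N₀` makes the
product at most `2 e^{-2/h}` (`setIntegral_le_half`). -/

namespace QuadBargmann

/-! ### Isotropy of the spectral subspaces and the form of the reduced symbol -/

/-- Generalized eigenvectors of a `B`-skew endomorphism `F` whose eigenvalues do not sum to zero are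
`B`-orthogonal. -/
theorem bilin_eq_zero_of_mem_maxGenEigenspace {V : Type*} [AddCommGroup V] [Module ℂ V]
    (B : LinearMap.BilinForm ℂ V) (F : Module.End ℂ V) (hF : ∀ X Y, B (F X) Y = -B X (F Y))
    {l m : ℂ} (hlm : l + m ≠ 0) {X Y : V} (hX : X ∈ F.maxGenEigenspace l)
    (hY : Y ∈ F.maxGenEigenspace m) : B X Y = 0 := by
  have key : ∀ N j k : ℕ, j + k ≤ N → ∀ X Y : V, ((F - l • (1 : Module.End ℂ V)) ^ j) X = 0 →
      ((F - m • (1 : Module.End ℂ V)) ^ k) Y = 0 → B X Y = 0 := by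
    intro N
    induction N with
    | zero =>
      intro j k hjk X Y hX _
      obtain rfl : j = 0 := by omega
      simp at hX
      simp [hX]
    | succ N ih =>
      intro j k hjk X Y hX hY
      rcases j with _ | j
      · simp at hX
        simp [hX]
      rcases k with _ | k
      · simp at hY
        simp [hY]
      have h1 := ih j (k + 1) (by omega) ((F - l • (1 : Module.End ℂ V)) X) Y
        (by rwa [pow_succ, Module.End.mul_apply] at hX) hY
      have h2 := ih (j + 1) k (by omega) X ((F - m • (1 : Module.End ℂ V)) Y) hX
        (by rwa [pow_succ, Module.End.mul_apply] at hY)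
      simp only [LinearMap.sub_apply, LinearMap.smul_apply, Module.End.one_apply, map_sub,
        map_smul, smul_eq_mul, hF] at h1 h2
      have h3 : (l + m) * B X Y = 0 := by linear_combination -h1 - h2
      exact (mul_eq_zero.mp h3).resolve_left hlm
  obtain ⟨j, hj⟩ := (Module.End.mem_maxGenEigenspace _ _ _).mp hX
  obtain ⟨k, hk⟩ := (Module.End.mem_maxGenEigenspace _ _ _).mp hY
  exact key (j + k) j k le_rfl X Y hj hk

theorem bilin_eq_zero_of_mem_iSup {V : Type*} [AddCommGroup V] [Module ℂ V]
    (B : LinearMap.BilinForm ℂ V) (F : Module.End ℂ V) (hF : ∀ X Y, B (F X) Y = -B X (F Y))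
    (p : ℂ → Prop) (hp : ∀ l m, p l → p m → l + m ≠ 0) {X Y : V}
    (hX : X ∈ ⨆ l : ℂ, ⨆ _ : p l, F.maxGenEigenspace l)
    (hY : Y ∈ ⨆ l : ℂ, ⨆ _ : p l, F.maxGenEigenspace l) : B X Y = 0 := by
  have h1 : ∀ m, p m → ∀ Z ∈ F.maxGenEigenspace m, B X Z = 0 := by
    intro m hm Z hZ
    have hle : ⨆ l : ℂ, ⨆ _ : p l, F.maxGenEigenspace l ≤ LinearMap.ker (B.flip Z) :=
      iSup₂_le fun l hl W hW => bilin_eq_zero_of_mem_maxGenEigenspace B F hF (hp l m hl hm) hW hZ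
    exact hle hX
  have hle : ⨆ l : ℂ, ⨆ _ : p l, F.maxGenEigenspace l ≤ LinearMap.ker (B X) :=
    iSup₂_le fun m hm Z hZ => h1 m hm Z hZ
  exact hle hY

variable {n : ℕ}

theorem polarization_comm (q : QuadraticForm ℂ (Phase n)) (X Y : Phase n) :
    polarization q X Y = polarization q Y X := by
  exact QuadraticMap.associated_isSymm ℂ q X Y

theorem sympl_neg_swap (X Y : Phase n) : sympl X Y = -sympl Y X := by
  simp only [sympl, dotProduct_comm]
  ring

/-- The Hamilton map is skew with respect to the polarization. -/
theorem polarization_hamiltonMap_left (q : QuadraticForm ℂ (Phase n)) (X Y : Phase n) :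
    polarization q (hamiltonMap q X) Y = -polarization q X (hamiltonMap q Y) := by
  rw [polarization_eq_sympl_hamiltonMap, sympl_neg_swap, ← polarization_eq_sympl_hamiltonMap,
    polarization_comm]

/-- `q` vanishes on a sum of generalized eigenspaces of its Hamilton map no two eigenvalues of which
sum to zero. -/
theorem apply_eq_zero_of_mem_iSup (q : QuadraticForm ℂ (Phase n)) (p : ℂ → Prop)
    (hp : ∀ l m, p l → p m → l + m ≠ 0) {X : Phase n}
    (hX : X ∈ ⨆ l : ℂ, ⨆ _ : p l, (hamiltonMap q).maxGenEigenspace l) : q X = 0 := by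
  have := bilin_eq_zero_of_mem_iSup _ _ (polarization_hamiltonMap_left q) p hp hX hX
  rw [polarization, QuadraticMap.associated_eq_self_apply] at this
  exact this

theorem apply_eq_zero_of_mem_lambdaPlus (q : QuadraticForm ℂ (Phase n)) {X : Phase n}
    (hX : X ∈ lambdaPlus q) : q X = 0 := by
  refine apply_eq_zero_of_mem_iSup q (fun l => 0 < l.im) (fun l m hl hm h => ?_) hX
  have := congrArg Complex.im h
  simp at this
  linarith

theorem apply_eq_zero_of_mem_lambdaMinus (q : QuadraticForm ℂ (Phase n)) {X : Phase n}
    (hX : X ∈ lambdaMinus q) : q X = 0 := by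
  refine apply_eq_zero_of_mem_iSup q (fun l => l.im < 0) (fun l m hl hm h => ?_) hX
  have := congrArg Complex.im h
  simp at this
  linarith

theorem disjoint_lambdaPlus_lambdaMinus (q : QuadraticForm ℂ (Phase n)) :
    Disjoint (lambdaPlus q) (lambdaMinus q) := by
  have h : Disjoint {l : ℂ | 0 < l.im} {l : ℂ | l.im < 0} :=
    Set.disjoint_left.mpr fun l (h1 : 0 < l.im) (h2 : l.im < 0) => lt_asymm h1 h2
  exact (Module.End.independent_maxGenEigenspace (hamiltonMap q)).disjoint_biSup_biSup h

variable {q : QuadraticForm ℂ (Phase n)} {S : Phase n ≃ₗ[ℂ] Phase n}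
  {A : Matrix (Fin n) (Fin n) ℂ}

/-- `Λ⁺` and `Λ⁻` being transversal, `-i` is not an eigenvalue of `A`, so that the inverse in the
definition of `B` is a genuine one. -/
theorem isUnit_one_sub_I_smul
    (hminus : ∀ Y : Phase n, Y ∈ (lambdaMinus q).map (S : Phase n →ₗ[ℂ] Phase n) ↔
      Y.2 = -Complex.I • Y.1)
    (hplus : ∀ Y : Phase n, Y ∈ (lambdaPlus q).map (S : Phase n →ₗ[ℂ] Phase n) ↔
      Y.2 = A *ᵥ Y.1) : IsUnit (1 - Complex.I • A) := by
  rw [← Matrix.mulVec_injective_iff_isUnit]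
  refine (injective_iff_map_eq_zero (Matrix.mulVecLin (1 - Complex.I • A))).mpr fun y hy => ?_
  have hy' : y = Complex.I • (A *ᵥ y) := by
    simpa [Matrix.sub_mulVec, Matrix.smul_mulVec, sub_eq_zero] using hy
  have hA : A *ᵥ y = -Complex.I • y := by
    conv_rhs => rw [hy']
    simp [smul_smul]
  obtain ⟨X, hX, hXY⟩ := (hplus (y, A *ᵥ y)).mpr rfl
  obtain ⟨X', hX', hXY'⟩ := (hminus (y, A *ᵥ y)).mpr hA
  have hXX : X = X' := S.injective (hXY.trans hXY'.symm)
  have h0 := (Submodule.disjoint_def.mp (disjoint_lambdaPlus_lambdaMinus q)) X hX (hXX ▸ hX')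
  rw [h0] at hXY
  exact (congrArg Prod.fst hXY).symm.trans rfl |>.trans (by simp)

theorem apply_symm_eq_zero_of_mem_map {L : Submodule ℂ (Phase n)} (hL : ∀ X ∈ L, q X = 0)
    {Y : Phase n} (hY : Y ∈ L.map (S : Phase n →ₗ[ℂ] Phase n)) : q (S.symm Y) = 0 := by
  obtain ⟨X, hX, rfl⟩ := hY
  simpa using hL X hX

/-- `q̃` vanishes on the fibre `x = 0`, the image of `Λ⁻`. -/
theorem qTilde_zero_left (C : GL (Fin n) ℂ)
    (hminus : ∀ Y : Phase n, Y ∈ (lambdaMinus q).map (S : Phase n →ₗ[ℂ] Phase n) ↔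
      Y.2 = -Complex.I • Y.1) (ξ : Fin n → ℂ) : qTilde q S A C (0, ξ) = 0 := by
  have : qTilde q S A C (0, ξ) = q (S.symm ((kappaT (matB A)).symm ((kappaC C).symm (0, ξ)))) := rfl
  rw [this]
  refine apply_symm_eq_zero_of_mem_map (fun X hX => apply_eq_zero_of_mem_lambdaMinus q hX)
    ((hminus _).mpr ?_)
  simp [kappaT, kappaC, smul_smul]

/-- `q̃` vanishes on the zero section `ξ = 0`, the image of `Λ⁺`. -/
theorem qTilde_zero_right (C : GL (Fin n) ℂ)
    (hminus : ∀ Y : Phase n, Y ∈ (lambdaMinus q).map (S : Phase n →ₗ[ℂ] Phase n) ↔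
      Y.2 = -Complex.I • Y.1)
    (hplus : ∀ Y : Phase n, Y ∈ (lambdaPlus q).map (S : Phase n →ₗ[ℂ] Phase n) ↔
      Y.2 = A *ᵥ Y.1) (x : Fin n → ℂ) : qTilde q S A C (x, 0) = 0 := by
  have : qTilde q S A C (x, 0) = q (S.symm ((kappaT (matB A)).symm ((kappaC C).symm (x, 0)))) := rfl
  rw [this]
  refine apply_symm_eq_zero_of_mem_map (fun X hX => apply_eq_zero_of_mem_lambdaPlus q hX)
    ((hplus _).mpr ?_)
  have hu := isUnit_one_sub_I_smul hminus hplus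
  have hB : (1 - Complex.I • A) * matB A = A := by
    rw [matB, ← mul_assoc, Matrix.mul_nonsing_inv _ ((Matrix.isUnit_iff_isUnit_det _).mp hu),
      one_mul]
  have hB' : matB A = A + Complex.I • (A * matB A) := by
    rw [sub_mul, one_mul, Matrix.smul_mul, sub_eq_iff_eq_add] at hB
    exact hB
  have hv : ∀ y, matB A *ᵥ y = A *ᵥ y + Complex.I • (A *ᵥ (matB A *ᵥ y)) := fun y => by
    conv_lhs => rw [hB']
    simp [Matrix.add_mulVec, Matrix.smul_mulVec]
  simpa [kappaT, kappaC, Matrix.mulVec_add, Matrix.mulVec_smul] using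
    hv ((C : Matrix (Fin n) (Fin n) ℂ) *ᵥ x)

theorem polarization_eq_zero_of_apply_eq_zero (Q : QuadraticForm ℂ (Phase n)) {X Y : Phase n}
    (hX : Q X = 0) (hY : Q Y = 0) (hXY : Q (X + Y) = 0) : polarization Q X Y = 0 := by
  simp [polarization, QuadraticMap.associated_apply, hX, hY, hXY]

/-! ### Holomorphic functions of several variables -/

section Holomorphic

variable {E : Type*} [NormedAddCommGroup E] [NormedSpace ℂ E]

/-- Mean value property of the difference quotient of an entire function. -/
theorem deriv_zero_eq_circleAverage {f : ℂ → ℂ} (hf : Differentiable ℂ f) :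
    deriv f 0 = Real.circleAverage (dslope f 0) 0 1 := by
  have h : Differentiable ℂ (dslope f 0) := by
    rw [← differentiableOn_univ] at hf ⊢
    exact (Complex.differentiableOn_dslope Filter.univ_mem).mpr hf
  rw [h.diffContOnCl.circleAverage, dslope_same]

theorem fderiv_apply_eq_intervalIntegral {f : E → ℂ} (hf : Differentiable ℂ f) (x v : E) :
    fderiv ℂ f x v = (2 * Real.pi)⁻¹ • ∫ θ in (0 : ℝ)..2 * Real.pi,
      (circleMap 0 1 θ)⁻¹ * (f (x + circleMap 0 1 θ • v) - f x) := by
  have hl : Differentiable ℂ fun t : ℂ => f (x + t • v) := by fun_prop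
  have h1 : fderiv ℂ f x v = deriv (fun t : ℂ => f (x + t • v)) 0 := by
    have h2 : HasFDerivAt f (fderiv ℂ f x) (x + (0 : ℂ) • v) := by
      simpa using (hf x).hasFDerivAt
    have h3 : HasDerivAt (fun t : ℂ => x + t • v) v 0 := by
      simpa using ((hasDerivAt_id (0 : ℂ)).smul_const v).const_add x
    exact (h2.comp_hasDerivAt 0 h3).deriv.symm
  rw [h1, deriv_zero_eq_circleAverage hl, Real.circleAverage_def]
  congr 1
  refine intervalIntegral.integral_congr fun θ _ => ?_
  have h0 : circleMap 0 1 θ ≠ 0 := circleMap_ne_center one_ne_zero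
  simp [dslope_of_ne _ h0, slope_def_field, div_eq_inv_mul]

/-- Directional derivatives of a holomorphic function of several variables are holomorphic: they
are circle averages of difference quotients, which may be differentiated under the integral, the
differential being locally bounded by the Schwarz lemma. -/
theorem differentiable_fderiv_apply {f : E → ℂ} (hf : Differentiable ℂ f) [FiniteDimensional ℂ E]
    (v : E) : Differentiable ℂ fun x => fderiv ℂ f x v := by
  have : CompleteSpace E := FiniteDimensional.complete ℂ E
  have : ProperSpace E := FiniteDimensional.proper ℂ E
  borelize E
  intro x₀
  have hfc := hf.continuous
  -- `f` is bounded by `M` on a ball containing all the points below together with a unit margin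
  obtain ⟨M, hM⟩ := (isCompact_closedBall x₀ (‖v‖ + 2)).exists_bound_of_continuousOn
    hfc.continuousOn
  have hbd : ∀ y ∈ Metric.closedBall x₀ (‖v‖ + 1), ‖fderiv ℂ f y‖ ≤ 2 * M := by
    intro y hy
    have hsub : ∀ z ∈ Metric.ball y 1, z ∈ Metric.closedBall x₀ (‖v‖ + 2) := by
      intro z hz
      have h1 : dist z x₀ ≤ dist z y + dist y x₀ := dist_triangle _ _ _
      rw [Metric.mem_ball] at hz
      rw [Metric.mem_closedBall] at hy ⊢
      linarith
    have := Complex.norm_fderiv_le_div_of_mapsTo_ball (f := f) (c := y) (R₁ := 1) (R₂ := 2 * M)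
      hf.differentiableOn (fun z hz => ?_) one_pos
    · simpa using this
    · rw [Metric.mem_closedBall, dist_eq_norm]
      have h1 := hM z (hsub z hz)
      have h2 := hM y (hsub y (Metric.mem_ball_self one_pos))
      exact (norm_sub_le _ _).trans (by linarith)
  have hcirc : ∀ θ, ‖circleMap 0 1 θ‖ = 1 := fun θ => by simp
  have hmeas : Measurable (fderiv ℂ f) := measurable_fderiv ℂ f
  have hcont : ∀ x, Continuous fun θ : ℝ =>
      (circleMap 0 1 θ)⁻¹ * (f (x + circleMap 0 1 θ • v) - f x) := by
    intro x
    have h1 : Continuous fun θ : ℝ => circleMap 0 1 θ := continuous_circleMap 0 1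
    refine (h1.inv₀ fun θ => circleMap_ne_center one_ne_zero).mul ?_
    fun_prop
  have hder := intervalIntegral.hasFDerivAt_integral_of_dominated_of_fderiv_le (𝕜 := ℂ)
    (μ := volume) (a := 0) (b := 2 * Real.pi) (x₀ := x₀) (s := Metric.ball x₀ 1)
    (F := fun x θ => (circleMap 0 1 θ)⁻¹ * (f (x + circleMap 0 1 θ • v) - f x))
    (F' := fun x θ => (circleMap 0 1 θ)⁻¹ •
      (fderiv ℂ f (x + circleMap 0 1 θ • v) - fderiv ℂ f x))
    (bound := fun _ => 2 * M + 2 * M) (Metric.ball_mem_nhds _ one_pos)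
    (Filter.Eventually.of_forall fun x => (hcont x).aestronglyMeasurable)
    ((hcont x₀).intervalIntegrable _ _) ?_ ?_ intervalIntegrable_const ?_
  · have : (fun x => fderiv ℂ f x v) = fun x => (2 * Real.pi)⁻¹ • ∫ θ in (0 : ℝ)..2 * Real.pi,
        (circleMap 0 1 θ)⁻¹ * (f (x + circleMap 0 1 θ • v) - f x) :=
      funext fun x => fderiv_apply_eq_intervalIntegral hf x v
    rw [this]
    exact (hder.const_smul ((2 * Real.pi)⁻¹ : ℝ)).differentiableAt
  · have h1 : Measurable fun θ : ℝ => circleMap 0 1 θ := (continuous_circleMap 0 1).measurable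
    have h2 : Measurable fun θ : ℝ => x₀ + circleMap 0 1 θ • v :=
      (by fun_prop : Continuous fun θ : ℝ => x₀ + circleMap 0 1 θ • v).measurable
    exact (h1.inv.smul ((hmeas.comp h2).sub_const _)).aestronglyMeasurable
  · refine Filter.Eventually.of_forall fun θ _ x hx => ?_
    rw [Metric.mem_ball] at hx
    have h1 := hbd (x + circleMap 0 1 θ • v) (by
      rw [Metric.mem_closedBall, dist_eq_norm]
      have : x + circleMap 0 1 θ • v - x₀ = (x - x₀) + circleMap 0 1 θ • v := by abel
      rw [this]
      refine (norm_add_le _ _).trans ?_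
      rw [norm_smul, hcirc, one_mul, ← dist_eq_norm]
      linarith)
    have h2 := hbd x (by
      rw [Metric.mem_closedBall]
      linarith [norm_nonneg v])
    rw [norm_smul, norm_inv, hcirc, inv_one, one_mul]
    exact (norm_sub_le _ _).trans (add_le_add h1 h2)
  · refine Filter.Eventually.of_forall fun θ _ x _ => ?_
    have h1 : HasFDerivAt (fun y => f (y + circleMap 0 1 θ • v))
        (fderiv ℂ f (x + circleMap 0 1 θ • v)) x :=
      (hasFDerivAt_comp_add_right _).mpr (hf _).hasFDerivAt
    exact (h1.sub (hf x).hasFDerivAt).const_smul ((circleMap 0 1 θ)⁻¹)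

theorem contDiff_of_differentiable [FiniteDimensional ℂ E] (N : ℕ) {f : E → ℂ}
    (hf : Differentiable ℂ f) : ContDiff ℂ N f := by
  induction N generalizing f with
  | zero => exact contDiff_zero.mpr hf.continuous
  | succ N ih =>
    push_cast
    refine (contDiff_succ_iff_fderiv_apply).mpr ⟨hf, by simp, fun v => ?_⟩
    exact ih (differentiable_fderiv_apply hf v)

end Holomorphic

/-! ### Entire functions of one variable with a zero of high order -/

/-- An entire function of one variable vanishing to order `N` at `0` is `t ^ N` times an entire
function. -/
theorem exists_eq_pow_mul (N : ℕ) {f : ℂ → ℂ} (hf : Differentiable ℂ f)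
    (h0 : ∀ k < N, iteratedDeriv k f 0 = 0) :
    ∃ g : ℂ → ℂ, Differentiable ℂ g ∧ ∀ t, f t = t ^ N * g t := by
  rw [← natCast_le_analyticOrderAt_iff_iteratedDeriv_eq_zero (hf.analyticAt 0)] at h0
  induction N generalizing f with
  | zero => exact ⟨f, hf, by simp⟩
  | succ N ih =>
    have hd : Differentiable ℂ (dslope f 0) := by
      rw [← differentiableOn_univ] at hf ⊢
      exact (Complex.differentiableOn_dslope Filter.univ_mem).mpr hf
    have hf0 : f 0 = 0 := by
      by_contra hne
      rw [analyticOrderAt_eq_zero.mpr (Or.inr hne)] at h0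
      simp at h0
    have hfd : f = (fun t => t) * dslope f 0 := by
      funext t
      have := sub_smul_dslope f 0 t
      simpa [hf0] using this.symm
    have hord : (N : ℕ∞) ≤ analyticOrderAt (dslope f 0) 0 := by
      rw [hfd, analyticOrderAt_mul (by fun_prop) (hd.analyticAt 0)] at h0
      have h1 : analyticOrderAt (fun t : ℂ => t) 0 = 1 :=
        analyticAt_id.analyticOrderAt_eq_one_of_zero_deriv_ne_zero rfl (by simp)
      rw [h1] at h0
      push_cast at h0
      rw [add_comm] at h0
      exact (ENat.add_le_add_iff_left (by simp)).mp h0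
    obtain ⟨g, hg, hgt⟩ := ih hd hord
    refine ⟨g, hg, fun t => ?_⟩
    have := congrFun hfd t
    rw [this, Pi.mul_apply, hgt]
    ring

/-- A weak form of the Schwarz lemma in the mean: for `f` entire vanishing to order `N`, the value
inside the disc is controlled by the mean square on the circle. -/
theorem norm_sq_le_of_vanishing (N : ℕ) {f : ℂ → ℂ} (hf : Differentiable ℂ f)
    (h0 : ∀ k < N, iteratedDeriv k f 0 = 0) {ρ : ℝ} (hρ : 0 ≤ ρ) (hρ1 : ρ ≤ 1 / 2) :
    ‖f ρ‖ ^ 2 ≤ 2 * ρ ^ (2 * N) * Real.circleAverage (fun t => ‖f t‖ ^ 2) 0 1 := by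
  obtain ⟨g, hg, hfg⟩ := exists_eq_pow_mul N hf h0
  have hmem : (ρ : ℂ) ∈ Metric.ball (0 : ℂ) |1| := by
    simp [abs_of_nonneg hρ]
    linarith
  have hg2 : Differentiable ℂ fun t => g t ^ 2 := hg.pow 2
  have hgc := hg.continuous
  have h1 := DiffContOnCl.circleAverage_smul_div (f := fun t => g t ^ 2) (c := 0) (R := 1)
    (w := (ρ : ℂ)) hg2.diffContOnCl hmem
  have hsph : ∀ t ∈ Metric.sphere (0 : ℂ) 1, (1 : ℝ) / 2 ≤ ‖t - ρ‖ := by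
    intro t ht
    have ht1 : ‖t‖ = 1 := by simpa using ht
    have := norm_sub_norm_le t (ρ : ℂ)
    rw [ht1, Complex.norm_real, Real.norm_eq_abs, abs_of_nonneg hρ] at this
    linarith
  have h2 : ‖g ρ ^ 2‖ ≤ 2 * Real.circleAverage (fun t => ‖f t‖ ^ 2) 0 1 := by
    rw [← h1, Real.circleAverage_def, Real.circleAverage_def, norm_smul, smul_eq_mul,
      mul_left_comm (2 : ℝ), Real.norm_of_nonneg (by positivity)]
    gcongr
    rw [← intervalIntegral.integral_const_mul]
    have hfc := hf.continuous
    refine intervalIntegral.norm_integral_le_of_norm_le (by positivity)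
      (Filter.Eventually.of_forall fun θ _ => ?_) (Continuous.intervalIntegrable (by
        have := continuous_circleMap 0 1
        fun_prop) _ _)
    have hθ : circleMap 0 1 θ ∈ Metric.sphere (0 : ℂ) 1 := circleMap_mem_sphere 0 zero_le_one θ
    have hn : ‖circleMap 0 1 θ‖ = 1 := by simp
    have h3 := hsph _ hθ
    simp only [sub_zero, smul_eq_mul, norm_mul, norm_div, hn, norm_pow, hfg, one_pow, one_mul]
    gcongr
    rw [div_le_iff₀ (by linarith)]
    linarith
  rw [hfg]
  simp only [norm_mul, norm_pow, Complex.norm_real, Real.norm_eq_abs, abs_of_nonneg hρ, mul_pow]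
  rw [norm_pow] at h2
  calc _ = ρ ^ (2 * N) * ‖g ρ‖ ^ 2 := by ring
    _ ≤ ρ ^ (2 * N) * (2 * Real.circleAverage (fun t => ‖f t‖ ^ 2) 0 1) := by gcongr
    _ = _ := by ring

/-- `L²` bound for the derivative at the centre, from the mean value property of the square of the
difference quotient. -/
theorem norm_deriv_sq_le {f : ℂ → ℂ} (hf : Differentiable ℂ f) :
    ‖deriv f 0‖ ^ 2 ≤ 2 * Real.circleAverage (fun t => ‖f t‖ ^ 2) 0 1 + 2 * ‖f 0‖ ^ 2 := by
  have hd : Differentiable ℂ (dslope f 0) := by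
    rw [← differentiableOn_univ] at hf ⊢
    exact (Complex.differentiableOn_dslope Filter.univ_mem).mpr hf
  have h1 : Real.circleAverage (fun t => dslope f 0 t ^ 2) 0 1 = deriv f 0 ^ 2 := by
    have h2 : Differentiable ℂ fun t => dslope f 0 t ^ 2 := hd.pow 2
    rw [h2.diffContOnCl.circleAverage, dslope_same]
  have hfc := hf.continuous
  have hcm := continuous_circleMap 0 1
  have h3 : 2 * Real.circleAverage (fun t => ‖f t‖ ^ 2) 0 1 + 2 * ‖f 0‖ ^ 2 =
      (2 * Real.pi)⁻¹ • ∫ θ in (0 : ℝ)..2 * Real.pi,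
        (2 * ‖f (circleMap 0 1 θ)‖ ^ 2 + 2 * ‖f 0‖ ^ 2) := by
    rw [intervalIntegral.integral_add (Continuous.intervalIntegrable (by fun_prop) _ _)
      intervalIntegrable_const, intervalIntegral.integral_const_mul,
      intervalIntegral.integral_const, Real.circleAverage_def]
    simp only [smul_eq_mul, sub_zero]
    field_simp
  rw [← norm_pow, ← h1, h3, Real.circleAverage_def, norm_smul, smul_eq_mul,
    Real.norm_of_nonneg (by positivity)]
  gcongr
  refine intervalIntegral.norm_integral_le_of_norm_le (by positivity)
    (Filter.Eventually.of_forall fun θ _ => ?_) (Continuous.intervalIntegrable (by fun_prop) _ _)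
  have hn : ‖circleMap 0 1 θ‖ = 1 := by simp
  have h0 : circleMap 0 1 θ ≠ 0 := circleMap_ne_center one_ne_zero
  rw [dslope_of_ne _ h0, slope_def_field, norm_pow, norm_div, sub_zero, hn, div_one]
  have h4 := norm_sub_le (f (circleMap 0 1 θ)) (f 0)
  nlinarith [norm_nonneg (f (circleMap 0 1 θ) - f 0), sq_nonneg (‖f (circleMap 0 1 θ)‖ - ‖f 0‖)]

/-- If all partial derivatives of `u` of order less than `N` vanish at the origin, so do the
derivatives of the restrictions of `u` to complex lines. -/
theorem VanishesToOrder.iteratedDeriv_line {N : ℕ} {u : (Fin n → ℂ) → ℂ}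
    (hu : Differentiable ℂ u) (hN : VanishesToOrder N u) (x : Fin n → ℂ) :
    ∀ k < N, iteratedDeriv k (fun t : ℂ => u (t • x)) 0 = 0 := by
  intro k hk
  have hzero : iteratedFDeriv ℂ k u 0 = 0 := by
    refine ContinuousMultilinearMap.toMultilinearMap_injective ?_
    refine Module.Basis.ext_multilinear (fun _ => Pi.basisFun ℂ (Fin n)) fun s => ?_
    simpa [Pi.basisFun_apply] using hN k hk s
  have hcomp : (fun t : ℂ => u (t • x)) =
      u ∘ (ContinuousLinearMap.toSpanSingleton ℂ x) := by
    funext t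
    simp
  rw [iteratedDeriv_eq_iteratedFDeriv, hcomp, ContinuousLinearMap.iteratedFDeriv_comp_right
    _ (contDiff_of_differentiable k hu) 0 le_rfl]
  simp [hzero]

/-! ### The weight and its `L²` space -/

section Weight

theorem continuous_normSq : Continuous (normSq : (Fin n → ℂ) → ℝ) := by
  unfold normSq
  fun_prop

theorem normSq_nonneg (x : Fin n → ℂ) : 0 ≤ normSq x :=
  Finset.sum_nonneg fun _ _ => by positivity

theorem norm_sq_le_normSq (x : Fin n → ℂ) : ‖x‖ ^ 2 ≤ normSq x := by
  have h1 : ∀ j, ‖x j‖ ≤ √(normSq x) := fun j =>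
    Real.le_sqrt_of_sq_le (Finset.single_le_sum (f := fun j => ‖x j‖ ^ 2)
      (fun _ _ => by positivity) (Finset.mem_univ j))
  calc ‖x‖ ^ 2 ≤ √(normSq x) ^ 2 := by
        gcongr
        exact (pi_norm_le_iff_of_nonneg (Real.sqrt_nonneg _)).mpr h1
    _ = normSq x := Real.sq_sqrt (normSq_nonneg x)

theorem normSq_smul (r : ℝ) (x : Fin n → ℂ) : normSq (r • x) = r ^ 2 * normSq x := by
  simp [normSq, Finset.mul_sum, mul_pow]

theorem normSq_smul_of_norm_eq_one {c : ℂ} (hc : ‖c‖ = 1) (x : Fin n → ℂ) :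
    normSq (c • x) = normSq x := by
  simp [normSq, hc]

/-- The weight `Φ₁` is a real quadratic form. -/
theorem exists_bilin_Phi1 (A : Matrix (Fin n) (Fin n) ℂ) (C : GL (Fin n) ℂ) :
    ∃ β : (Fin n → ℂ) →L[ℝ] (Fin n → ℂ) →L[ℝ] ℝ, Phi1 A C = fun x => β x x := by
  let c : (Fin n → ℂ) → (Fin n → ℂ) := fun x => (C : Matrix (Fin n) (Fin n) ℂ) *ᵥ x
  have hadd : ∀ x y, c (x + y) = c x + c y := fun x y => Matrix.mulVec_add _ _ _
  have hsmul : ∀ (r : ℝ) x, c (r • x) = r • c x := fun r x => Matrix.mulVec_smul _ _ _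
  let β₀ : (Fin n → ℂ) →ₗ[ℝ] (Fin n → ℂ) →ₗ[ℝ] ℝ := LinearMap.mk₂ ℝ
    (fun x y => (1 / 2) * (∑ j, (c x j).im * (c y j).im + ((matB A *ᵥ c x) ⬝ᵥ c y).im))
    (fun x x' y => by
      simp only [hadd, Pi.add_apply, Complex.add_im, add_mul, Finset.sum_add_distrib,
        Matrix.mulVec_add, add_dotProduct]
      ring)
    (fun r x y => by
      simp only [hsmul, Pi.smul_apply, Complex.smul_im, smul_eq_mul, mul_assoc, ← Finset.mul_sum,
        Matrix.mulVec_smul, smul_dotProduct]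
      ring)
    (fun x y y' => by
      simp only [hadd, Pi.add_apply, Complex.add_im, mul_add, Finset.sum_add_distrib,
        dotProduct_add]
      ring)
    (fun r x y => by
      simp only [hsmul, Pi.smul_apply, Complex.smul_im, smul_eq_mul, mul_left_comm _ r,
        ← Finset.mul_sum, dotProduct_smul, ← mul_add])
  refine ⟨LinearMap.toContinuousLinearMap ((LinearMap.toContinuousLinearMap :
    ((Fin n → ℂ) →ₗ[ℝ] ℝ) ≃ₗ[ℝ] ((Fin n → ℂ) →L[ℝ] ℝ)).toLinearMap ∘ₗ β₀), ?_⟩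
  funext x
  simp [β₀, Phi1, Phi0, c, pow_two]

/-- As `Φ₁` is the sum of `|Cx|² / 4` and a pluriharmonic quadratic form, its values at `x` and
`i x` cannot both be negative. -/
theorem Phi1_add_Phi1_I_smul_nonneg (A : Matrix (Fin n) (Fin n) ℂ) (C : GL (Fin n) ℂ)
    (x : Fin n → ℂ) : 0 ≤ Phi1 A C x + Phi1 A C (Complex.I • x) := by
  unfold Phi1 Phi0
  simp only [Matrix.mulVec_smul, smul_dotProduct, dotProduct_smul, smul_eq_mul, ← mul_assoc,
    Complex.I_mul_I, Pi.smul_apply]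
  have h1 : 0 ≤ ∑ j, (((C : Matrix (Fin n) (Fin n) ℂ) *ᵥ x) j).im ^ 2 :=
    Finset.sum_nonneg fun _ _ => sq_nonneg _
  have h2 : 0 ≤ ∑ j, (Complex.I * ((C : Matrix (Fin n) (Fin n) ℂ) *ᵥ x) j).im ^ 2 :=
    Finset.sum_nonneg fun _ _ => sq_nonneg _
  simp only [neg_mul, one_mul, Complex.neg_im]
  linarith

theorem neg_le_Phi1 {A : Matrix (Fin n) (Fin n) ℂ} {C : GL (Fin n) ℂ} {C₁ : ℝ}
    (hΦ : ∀ x, Phi1 A C x ≤ C₁ * normSq x) (x : Fin n → ℂ) : -(C₁ * normSq x) ≤ Phi1 A C x := by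
  have h1 := Phi1_add_Phi1_I_smul_nonneg A C x
  have h2 := hΦ (Complex.I • x)
  rw [normSq_smul_of_norm_eq_one Complex.norm_I] at h2
  linarith

variable {h : ℝ} {Φ : (Fin n → ℂ) → ℝ}

theorem memL2_iff_integrable (hΦ : Continuous Φ) {u : (Fin n → ℂ) → ℂ} (hu : Continuous u) :
    MemL2 h Φ u ↔ Integrable fun x => ‖u x‖ ^ 2 * Real.exp (-2 * Φ x / h) := by
  unfold MemL2
  rw [memLp_two_iff_integrable_sq_norm hu.aestronglyMeasurable, weightMeasure,
    integrable_withDensity_iff (by fun_prop) (Filter.Eventually.of_forall fun _ => by simp)]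
  simp only [ENNReal.toReal_ofReal (Real.exp_nonneg _)]

theorem normH_sq_eq_integral (hΦ : Continuous Φ) {u : (Fin n → ℂ) → ℂ}
    (hu : MemL2 h Φ u) : normH h Φ u ^ 2 = ∫ x, ‖u x‖ ^ 2 * Real.exp (-2 * Φ x / h) := by
  unfold normH
  rw [MemLp.eLpNorm_eq_integral_rpow_norm (by simp) (by simp) hu, ENNReal.toReal_ofReal
    (by positivity), ← Real.rpow_natCast, ← Real.rpow_mul (by positivity), weightMeasure,
    integral_withDensity_eq_integral_toReal_smul (by fun_prop)
    (Filter.Eventually.of_forall fun _ => by simp)]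
  simp [mul_comm, Real.exp_nonneg]

end Weight

/-! ### Averages over circles of measure preserving maps -/

section Averages

/-- Averaging an integrable function over a circle of volume preserving transformations preserves
its integral. -/
theorem integrable_average {T : ℝ → (Fin n → ℂ) → (Fin n → ℂ)}
    (hT : Continuous (Function.uncurry T)) (hmp : ∀ θ, MeasurePreserving (T θ))
    {G : (Fin n → ℂ) → ℝ} (hG : Integrable G) (hm : Measurable G) :
    Integrable (fun x => (2 * Real.pi)⁻¹ * ∫ θ in (0 : ℝ)..2 * Real.pi, G (T θ x)) ∧
      ∫ x, (2 * Real.pi)⁻¹ * ∫ θ in (0 : ℝ)..2 * Real.pi, G (T θ x) = ∫ x, G x := by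
  have hpi : (0 : ℝ) ≤ 2 * Real.pi := by positivity
  have hTm : Measurable fun p : (Fin n → ℂ) × ℝ => G (T p.2 p.1) :=
    hm.comp (hT.measurable.comp measurable_swap)
  have hcomp : ∀ θ, Integrable fun x => G (T θ x) := fun θ =>
    (hmp θ).integrable_comp_of_integrable hG
  have hint : ∀ (H : (Fin n → ℂ) → ℝ), Measurable H → ∀ θ, ∫ x, H (T θ x) = ∫ x, H x := by
    intro H hH θ
    conv_rhs => rw [← (hmp θ).map_eq]
    exact (integral_map (hmp θ).measurable.aemeasurable hH.aestronglyMeasurable).symm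
  have hprod : Integrable (fun p : (Fin n → ℂ) × ℝ => G (T p.2 p.1))
      ((volume : Measure (Fin n → ℂ)).prod (volume.restrict (Set.Ioc 0 (2 * Real.pi)))) := by
    rw [integrable_prod_iff' hTm.aestronglyMeasurable]
    refine ⟨Filter.Eventually.of_forall hcomp, ?_⟩
    simp only [hint (fun x => ‖G x‖) hm.norm]
    exact integrable_const _
  simp only [intervalIntegral.integral_of_le hpi]
  refine ⟨hprod.integral_prod_left.const_mul _, ?_⟩
  rw [integral_const_mul, integral_integral_swap hprod]
  simp only [hint G hm, integral_const, measureReal_restrict_apply_univ,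
    Real.volume_real_Ioc_of_le hpi, smul_eq_mul]
  field_simp
  simp

theorem measurePreserving_smul_of_norm_eq_one {c : ℂ} (hc : ‖c‖ = 1) :
    MeasurePreserving (fun x : Fin n → ℂ => c • x) := by
  have h1 : MeasurePreserving (fun z : ℂ => c * z) :=
    (rotation ⟨c, mem_sphere_zero_iff_norm.mpr hc⟩).measurePreserving
  exact volume_preserving_pi fun _ => h1

end Averages

/-! ### Smallness of the mass near a zero of high order -/

section Vanishing

theorem isCompact_normSq_le (r : ℝ) : IsCompact {x : Fin n → ℂ | normSq x ≤ r} := by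
  refine (isCompact_closedBall (0 : Fin n → ℂ) √r).of_isClosed_subset
    (isClosed_le continuous_normSq continuous_const) fun x hx => ?_
  rw [mem_closedBall_zero_iff]
  exact Real.le_sqrt_of_sq_le ((norm_sq_le_normSq x).trans hx)

open scoped Pointwise in
/-- Decay of the mass of a holomorphic function vanishing to order `N` near the origin. -/
theorem setIntegral_norm_sq_le_of_vanishing {N : ℕ} {u : (Fin n → ℂ) → ℂ}
    (hu : Differentiable ℂ u) (hN : VanishesToOrder N u) {ρ : ℝ} (hρ : 0 < ρ) (hρ1 : ρ ≤ 1 / 2)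
    (R : ℝ) : ∫ x in {x | normSq x ≤ (ρ * R) ^ 2}, ‖u x‖ ^ 2 ≤
      2 * ρ ^ (2 * N) * ∫ x in {x | normSq x ≤ R ^ 2}, ‖u x‖ ^ 2 := by
  have huc := hu.continuous
  set B : Set (Fin n → ℂ) := {x | normSq x ≤ R ^ 2} with hB
  have hBm : MeasurableSet B := measurableSet_le continuous_normSq.measurable measurable_const
  have hscale : {x : Fin n → ℂ | normSq x ≤ (ρ * R) ^ 2} = ρ • B := by
    ext x
    rw [Set.mem_smul_set_iff_inv_smul_mem₀ hρ.ne', hB, Set.mem_ofPred_eq, Set.mem_ofPred_eq,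
      normSq_smul, inv_pow, inv_mul_le_iff₀ (by positivity), mul_pow]
  set G : (Fin n → ℂ) → ℝ := B.indicator fun x => ‖u x‖ ^ 2 with hG
  have hGi : Integrable G := by
    rw [hG, integrable_indicator_iff hBm]
    exact (by fun_prop : Continuous fun x => ‖u x‖ ^ 2).continuousOn.integrableOn_compact
      (isCompact_normSq_le _)
  have hGm : Measurable G := Measurable.indicator (by fun_prop) hBm
  have hcm := continuous_circleMap 0 1
  obtain ⟨havi, hav⟩ := integrable_average (T := fun θ x => circleMap 0 1 θ • x)
    (by fun_prop) (fun θ => measurePreserving_smul_of_norm_eq_one (by simp)) hGi hGm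
  have h1 : ∫ x in B, ‖u (ρ • x)‖ ^ 2 ≤ 2 * ρ ^ (2 * N) * ∫ x in B, ‖u x‖ ^ 2 := by
    rw [← integral_indicator hBm, ← integral_indicator hBm, ← hG, ← hav, ← integral_const_mul]
    refine integral_mono_of_nonneg (Filter.Eventually.of_forall fun x => ?_)
      (havi.const_mul _) (Filter.Eventually.of_forall fun x => ?_)
    · exact Set.indicator_nonneg (fun _ _ => by positivity) x
    · have hmem : ∀ θ, circleMap 0 1 θ • x ∈ B ↔ x ∈ B := fun θ => by
        rw [hB, Set.mem_ofPred_eq, Set.mem_ofPred_eq, normSq_smul_of_norm_eq_one (by simp)]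
      by_cases hx : x ∈ B
      · have hGx : ∀ θ, G (circleMap 0 1 θ • x) = ‖u (circleMap 0 1 θ • x)‖ ^ 2 := fun θ =>
          Set.indicator_of_mem ((hmem θ).mpr hx) _
        have := norm_sq_le_of_vanishing N (f := fun t : ℂ => u (t • x)) (by fun_prop)
          (hN.iteratedDeriv_line hu x) hρ.le hρ1
        rw [Real.circleAverage_def] at this
        simp only [Set.indicator_of_mem hx, hGx]
        exact this
      · have hGx : ∀ θ, G (circleMap 0 1 θ • x) = 0 := fun θ =>
          Set.indicator_of_notMem (fun h => hx ((hmem θ).mp h)) _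
        simp [Set.indicator_of_notMem hx, hGx]
  rw [Measure.setIntegral_comp_smul_of_pos volume (fun x => ‖u x‖ ^ 2) B hρ, ← hscale,
    smul_eq_mul] at h1
  refine le_trans ?_ h1
  refine le_mul_of_one_le_left (integral_nonneg fun _ => by positivity) ?_
  exact (one_le_inv₀ (by positivity)).mpr (pow_le_one₀ hρ.le (by linarith))

/-- A function vanishing to the order in question has at most half of its mass in `|x| ≤ K`. With
`R = (K + 1) e` the gain `(K / R) ^ (2 N)` beats the oscillation of the weight on `|x| ≤ R`. -/
theorem setIntegral_le_half {h : ℝ} (hh : 0 < h) (hh1 : h ≤ 1) {Φ : (Fin n → ℂ) → ℝ}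
    (hΦc : Continuous Φ) {C₁ : ℝ} (hC₁ : 1 ≤ C₁) (hΦ : ∀ x, Φ x ≤ C₁ * normSq x)
    (hΦ' : ∀ x, -(C₁ * normSq x) ≤ Φ x) {K : ℝ} (hK : 0 < K) {u : (Fin n → ℂ) → ℂ}
    (hu : Differentiable ℂ u)
    (hN : VanishesToOrder ⌈(2 * C₁ * (K + 1) ^ 2 * Real.exp 1 ^ 2 + 1) / h⌉₊ u)
    (hui : Integrable fun x => ‖u x‖ ^ 2 * Real.exp (-2 * Φ x / h)) :
    ∫ x in {x | normSq x ≤ K ^ 2}, ‖u x‖ ^ 2 * Real.exp (-2 * Φ x / h) ≤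
      (1 / 2) * ∫ x, ‖u x‖ ^ 2 * Real.exp (-2 * Φ x / h) := by
  have huc := hu.continuous
  set N := ⌈(2 * C₁ * (K + 1) ^ 2 * Real.exp 1 ^ 2 + 1) / h⌉₊ with hNdef
  set R : ℝ := (K + 1) * Real.exp 1 with hR
  have he : 0 < Real.exp 1 := Real.exp_pos 1
  have he2 : 2 ≤ Real.exp 1 := by linarith [Real.add_one_le_exp (1 : ℝ)]
  have hRpos : 0 < R := by positivity
  have hKR : K ≤ R := by nlinarith
  have hρle : K / R ≤ (Real.exp 1)⁻¹ := by
    rw [hR, div_le_iff₀ (by positivity)]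
    field_simp
    linarith
  have hρ1 : K / R ≤ 1 / 2 := hρle.trans (by
    rw [one_div]
    exact inv_anti₀ two_pos he2)
  have hball : ∀ r : ℝ, MeasurableSet {x : Fin n → ℂ | normSq x ≤ r} := fun r =>
    measurableSet_le continuous_normSq.measurable measurable_const
  have hon : ∀ (f : (Fin n → ℂ) → ℝ) (r : ℝ), Continuous f →
      IntegrableOn f {x : Fin n → ℂ | normSq x ≤ r} := fun f r hf =>
    hf.continuousOn.integrableOn_compact (isCompact_normSq_le r)
  -- the weight is bounded above on the small ball and below on the large one
  have h1 : ∫ x in {x | normSq x ≤ K ^ 2}, ‖u x‖ ^ 2 * Real.exp (-2 * Φ x / h) ≤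
      Real.exp (2 * C₁ * K ^ 2 / h) * ∫ x in {x | normSq x ≤ K ^ 2}, ‖u x‖ ^ 2 := by
    rw [← integral_const_mul]
    refine setIntegral_mono_on (hon _ _ (by fun_prop)) (hon _ _ (by fun_prop)) (hball _)
      fun x hx => ?_
    rw [mul_comm]
    refine mul_le_mul_of_nonneg_right (Real.exp_le_exp.mpr
      (div_le_div_of_nonneg_right ?_ hh.le)) (by positivity)
    have h2 : C₁ * normSq x ≤ C₁ * K ^ 2 := mul_le_mul_of_nonneg_left hx (by linarith)
    linarith [hΦ' x]
  have h2 := setIntegral_norm_sq_le_of_vanishing hu hN (div_pos hK hRpos) hρ1 R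
  rw [div_mul_cancel₀ _ hRpos.ne'] at h2
  have h3 : ∫ x in {x | normSq x ≤ R ^ 2}, ‖u x‖ ^ 2 ≤
      Real.exp (2 * C₁ * R ^ 2 / h) * ∫ x, ‖u x‖ ^ 2 * Real.exp (-2 * Φ x / h) := by
    calc _ ≤ ∫ x in {x | normSq x ≤ R ^ 2}, Real.exp (2 * C₁ * R ^ 2 / h) *
          (‖u x‖ ^ 2 * Real.exp (-2 * Φ x / h)) := by
          refine setIntegral_mono_on (hon _ _ (by fun_prop)) (hon _ _ (by fun_prop)) (hball _)
            fun x hx => ?_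
          rw [mul_left_comm, ← Real.exp_add]
          refine le_mul_of_one_le_right (by positivity) (Real.one_le_exp ?_)
          rw [← add_div]
          have h2 : C₁ * normSq x ≤ C₁ * R ^ 2 := mul_le_mul_of_nonneg_left hx (by linarith)
          exact div_nonneg (by linarith [hΦ x]) hh.le
      _ ≤ _ := by
          rw [integral_const_mul]
          exact mul_le_mul_of_nonneg_left (setIntegral_le_integral hui
            (Filter.Eventually.of_forall fun x => by positivity)) (Real.exp_nonneg _)
  have h4 : (K / R) ^ (2 * N) ≤ Real.exp (-(2 * N)) := by
    calc (K / R) ^ (2 * N) ≤ (Real.exp 1)⁻¹ ^ (2 * N) := by gcongr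
      _ = Real.exp (-(2 * N)) := by
        rw [← Real.exp_neg, ← Real.exp_nat_mul]
        push_cast
        ring_nf
  have h5 : (2 * C₁ * R ^ 2 + 1) / h ≤ N := by
    refine le_trans (le_of_eq ?_) (Nat.le_ceil _)
    rw [hR]
    ring
  have h6 : 2 * C₁ * K ^ 2 / h + (-(2 * N) + 2 * C₁ * R ^ 2 / h) ≤ -2 := by
    have h7 : C₁ * K ^ 2 ≤ C₁ * R ^ 2 := by gcongr
    rw [div_le_iff₀ hh] at h5
    have : 2 * C₁ * K ^ 2 / h + (-(2 * N) + 2 * C₁ * R ^ 2 / h) =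
        (2 * C₁ * K ^ 2 + 2 * C₁ * R ^ 2 - 2 * (N * h)) / h := by
      field_simp
      ring
    rw [this, div_le_iff₀ hh]
    linarith
  have h8 : Real.exp (-2 : ℝ) ≤ 1 / 4 := by
    have : Real.exp (-2 : ℝ) = (Real.exp 1 ^ 2)⁻¹ := by
      rw [← Real.exp_nat_mul, ← Real.exp_neg]
      norm_num
    rw [this, one_div]
    exact inv_anti₀ (by norm_num) (by nlinarith)
  set I := ∫ x, ‖u x‖ ^ 2 * Real.exp (-2 * Φ x / h) with hI
  have hI0 : 0 ≤ I := integral_nonneg fun x => by positivity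
  calc _ ≤ Real.exp (2 * C₁ * K ^ 2 / h) *
        (2 * Real.exp (-(2 * N)) * (Real.exp (2 * C₁ * R ^ 2 / h) * I)) := by
        refine h1.trans (mul_le_mul_of_nonneg_left (h2.trans ?_) (Real.exp_nonneg _))
        gcongr
    _ = 2 * Real.exp (2 * C₁ * K ^ 2 / h + (-(2 * N) + 2 * C₁ * R ^ 2 / h)) * I := by
        rw [Real.exp_add, Real.exp_add]
        ring
    _ ≤ 2 * Real.exp (-2) * I := by gcongr
    _ ≤ 2 * (1 / 4) * I := by gcongr
    _ = (1 / 2) * I := by ring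

end Vanishing

/-! ### Square integrability of derivatives -/

section Derivative

/-- In a quadratic weight one gains control of a derivative of a holomorphic function at the cost of
one power of `x`: on each unit disc the weight is the squared modulus of an exponential, up to a
bounded factor, and Cauchy's estimate applies to the product with that exponential. -/
theorem integrable_norm_fderiv_sq {h : ℝ} (hh : 0 < h)
    (β : (Fin n → ℂ) →L[ℝ] (Fin n → ℂ) →L[ℝ] ℝ) {u : (Fin n → ℂ) → ℂ} (hu : Differentiable ℂ u)
    (hui : Integrable fun x => (1 + normSq x) ^ 2 * (‖u x‖ ^ 2 * Real.exp (-2 * β x x / h)))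
    (k : Fin n) :
    Integrable fun x => (1 + ‖x‖ ^ 2) *
      (‖fderiv ℂ u x (Pi.single k 1)‖ ^ 2 * Real.exp (-2 * β x x / h)) := by
  set e : Fin n → ℂ := Pi.single k 1 with he
  have hen : ‖e‖ = 1 := by simp [he, Pi.norm_single]
  have huc := hu.continuous
  have hdu : Continuous fun x => fderiv ℂ u x e := (differentiable_fderiv_apply hu e).continuous
  set W : (Fin n → ℂ) → ℝ := fun x => Real.exp (-2 * β x x / h) with hW
  have hWc : Continuous W := by fun_prop
  set G : (Fin n → ℂ) → ℝ := fun x => (1 + ‖x‖ ^ 2) * (‖u x‖ ^ 2 * W x) with hG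
  have hGc : Continuous G := by fun_prop
  have hnsc : Continuous (normSq : (Fin n → ℂ) → ℝ) := continuous_normSq
  have hGi : Integrable G := by
    refine hui.mono' hGc.aestronglyMeasurable (Filter.Eventually.of_forall fun x => ?_)
    rw [Real.norm_of_nonneg (by positivity)]
    refine mul_le_mul_of_nonneg_right ?_ (by positivity)
    nlinarith [norm_sq_le_normSq x, normSq_nonneg x]
  have hcm := continuous_circleMap 0 1
  have havi := (integrable_average (T := fun θ x => x + circleMap 0 1 θ • e)
    (by fun_prop) (fun θ => measurePreserving_add_right _ _) hGi hGc.measurable).1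
  refine ((havi.const_mul (12 * Real.exp (2 * ‖β‖ / h))).add
    (hui.const_mul (4 + 32 * (‖β‖ / h) ^ 2))).mono' (by fun_prop)
    (Filter.Eventually.of_forall fun x => ?_)
  rw [Real.norm_of_nonneg (by positivity), Pi.add_apply]
  -- `Re (a t)` is the derivative of the weight at `x` in the direction `t • e`
  set a : ℂ := ((β x e + β e x : ℝ) : ℂ) -
    ((β x (Complex.I • e) + β (Complex.I • e) x : ℝ) : ℂ) * Complex.I with ha
  have hat : ∀ t : ℂ, (a * t).re = β x (t • e) + β (t • e) x := by
    intro t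
    have h1 : t • e = t.re • e + t.im • (Complex.I • e) := by
      conv_lhs => rw [← Complex.re_add_im t]
      rw [add_smul, mul_smul, Complex.coe_smul, Complex.coe_smul]
    rw [h1]
    simp [ha, map_add, map_smul]
    ring
  have han : ‖a‖ ≤ 4 * ‖β‖ * ‖x‖ := by
    have hb : ∀ y z : Fin n → ℂ, ‖y‖ ≤ ‖x‖ → ‖z‖ ≤ 1 → |β y z| ≤ ‖β‖ * ‖x‖ := fun y z hy hz =>
      (β.le_opNorm₂ y z).trans (by
        calc ‖β‖ * ‖y‖ * ‖z‖ ≤ ‖β‖ * ‖x‖ * 1 := by gcongr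
          _ = _ := mul_one _)
    have hb' : ∀ z : Fin n → ℂ, ‖z‖ ≤ 1 → |β z x| ≤ ‖β‖ * ‖x‖ := fun z hz =>
      (β.le_opNorm₂ z x).trans (by
        calc ‖β‖ * ‖z‖ * ‖x‖ ≤ ‖β‖ * 1 * ‖x‖ := by gcongr
          _ = _ := by rw [mul_one])
    have hIe : ‖Complex.I • e‖ = 1 := by rw [norm_smul, Complex.norm_I, hen, one_mul]
    refine (norm_sub_le _ _).trans ?_
    rw [norm_mul, Complex.norm_I, mul_one, Complex.norm_real, Complex.norm_real]
    refine (add_le_add (norm_add_le _ _) (norm_add_le _ _)).trans ?_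
    simp only [Real.norm_eq_abs]
    linarith [hb x e le_rfl hen.le, hb' e hen.le, hb x _ le_rfl hIe.le, hb' _ hIe.le]
  set v : ℂ → ℂ := fun t => u (x + t • e) * Complex.exp (-(a * t) / h) with hv
  have hvd : Differentiable ℂ v := by fun_prop
  have hv0 : v 0 = u x := by simp [hv]
  have hvder : deriv v 0 = fderiv ℂ u x e - a / h * u x := by
    have h2 : HasFDerivAt u (fderiv ℂ u x) (x + (0 : ℂ) • e) := by
      simpa using (hu x).hasFDerivAt
    have h3 : HasDerivAt (fun t : ℂ => x + t • e) e 0 := by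
      simpa using ((hasDerivAt_id (0 : ℂ)).smul_const e).const_add x
    have h4 : HasDerivAt (fun t : ℂ => Complex.exp (-(a * t) / h)) (-(a / h)) 0 := by
      have h5 : HasDerivAt (fun t : ℂ => -(a * t) / h) (-(a * 1) / h) 0 :=
        (((hasDerivAt_id (0 : ℂ)).const_mul a).neg).div_const _
      simpa [neg_div] using h5.cexp
    have := ((h2.comp_hasDerivAt 0 h3).mul h4).deriv
    refine this.trans ?_
    simp
    ring
  have hvW : ∀ θ : ℝ, ‖v (circleMap 0 1 θ)‖ ^ 2 * W x * (1 + ‖x‖ ^ 2) ≤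
      3 * Real.exp (2 * ‖β‖ / h) * G (x + circleMap 0 1 θ • e) := by
    intro θ
    set t := circleMap 0 1 θ
    have ht : ‖t‖ = 1 := by simp [t]
    have hte : ‖t • e‖ = 1 := by rw [norm_smul, ht, hen, one_mul]
    have h1 : ‖v t‖ ^ 2 * W x =
        ‖u (x + t • e)‖ ^ 2 * W (x + t • e) * Real.exp (2 * β (t • e) (t • e) / h) := by
      have h2 : (-(a * t) / (h : ℂ)).re = -(β x (t • e) + β (t • e) x) / h := by
        rw [Complex.div_ofReal_re, Complex.neg_re, hat]
      rw [hv, hW]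
      simp only [norm_mul, mul_pow, Complex.norm_exp, h2]
      rw [← Real.exp_nat_mul, mul_assoc, mul_assoc, ← Real.exp_add, ← Real.exp_add]
      congr 2
      simp only [map_add, add_apply]
      push_cast
      ring
    have h2 : β (t • e) (t • e) ≤ ‖β‖ := by
      have := β.le_opNorm₂ (t • e) (t • e)
      rw [hte, mul_one, mul_one] at this
      exact (le_abs_self _).trans this
    have h3 : 1 + ‖x‖ ^ 2 ≤ 3 * (1 + ‖x + t • e‖ ^ 2) := by
      have h4 := norm_sub_le (x + t • e) (t • e)
      rw [add_sub_cancel_right, hte] at h4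
      nlinarith [norm_nonneg x, norm_nonneg (x + t • e), sq_nonneg (‖x + t • e‖ - 1)]
    rw [h1, hG]
    calc _ ≤ ‖u (x + t • e)‖ ^ 2 * W (x + t • e) * Real.exp (2 * ‖β‖ / h) *
          (3 * (1 + ‖x + t • e‖ ^ 2)) := by gcongr
      _ = _ := by ring
  have hest := norm_deriv_sq_le hvd
  rw [hvder, hv0, Real.circleAverage_def, smul_eq_mul] at hest
  have havg : ((2 * Real.pi)⁻¹ * ∫ θ in (0 : ℝ)..2 * Real.pi, ‖v (circleMap 0 1 θ)‖ ^ 2) *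
      (W x * (1 + ‖x‖ ^ 2)) ≤ 3 * Real.exp (2 * ‖β‖ / h) *
      ((2 * Real.pi)⁻¹ * ∫ θ in (0 : ℝ)..2 * Real.pi, G (x + circleMap 0 1 θ • e)) := by
    rw [mul_assoc, mul_left_comm (3 * Real.exp (2 * ‖β‖ / h))]
    refine mul_le_mul_of_nonneg_left ?_ (by positivity)
    rw [← intervalIntegral.integral_mul_const, ← intervalIntegral.integral_const_mul]
    have hvc := hvd.continuous
    refine intervalIntegral.integral_mono_on (by positivity)
      (Continuous.intervalIntegrable (by fun_prop) _ _)
      (Continuous.intervalIntegrable (by fun_prop) _ _) fun θ _ => ?_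
    rw [← mul_assoc]
    exact hvW θ
  have hsplit : ‖fderiv ℂ u x e‖ ^ 2 ≤
      2 * ‖fderiv ℂ u x e - a / h * u x‖ ^ 2 + 32 * (‖β‖ / h) ^ 2 * ‖x‖ ^ 2 * ‖u x‖ ^ 2 := by
    have h1 := norm_add_le (fderiv ℂ u x e - a / h * u x) (a / h * u x)
    rw [sub_add_cancel] at h1
    have h2 : ‖a / h * u x‖ ≤ 4 * (‖β‖ / h) * ‖x‖ * ‖u x‖ := by
      rw [norm_mul, norm_div, Complex.norm_real, Real.norm_of_nonneg hh.le]
      gcongr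
      rw [div_le_iff₀ hh]
      field_simp
      linarith
    have h3 : ‖a / h * u x‖ ^ 2 ≤ (4 * (‖β‖ / h) * ‖x‖ * ‖u x‖) ^ 2 := by gcongr
    nlinarith [sq_nonneg (‖fderiv ℂ u x e - a / h * u x‖ - ‖a / h * u x‖),
      norm_nonneg (fderiv ℂ u x e)]
  set A := (2 * Real.pi)⁻¹ * ∫ θ in (0 : ℝ)..2 * Real.pi, ‖v (circleMap 0 1 θ)‖ ^ 2
  set A' := (2 * Real.pi)⁻¹ * ∫ θ in (0 : ℝ)..2 * Real.pi, G (x + circleMap 0 1 θ • e)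
  have hWx : 0 ≤ W x := Real.exp_nonneg _
  have hns := norm_sq_le_normSq x
  have hns0 := normSq_nonneg x
  calc (1 + ‖x‖ ^ 2) * (‖fderiv ℂ u x e‖ ^ 2 * W x)
      ≤ (1 + ‖x‖ ^ 2) * ((2 * (2 * A + 2 * ‖u x‖ ^ 2) +
        32 * (‖β‖ / h) ^ 2 * ‖x‖ ^ 2 * ‖u x‖ ^ 2) * W x) := by
        gcongr
        exact hsplit.trans (by gcongr)
    _ = 4 * (A * (W x * (1 + ‖x‖ ^ 2))) + (4 * (1 + ‖x‖ ^ 2) +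
        32 * (‖β‖ / h) ^ 2 * (‖x‖ ^ 2 * (1 + ‖x‖ ^ 2))) * (‖u x‖ ^ 2 * W x) := by ring
    _ ≤ 4 * (3 * Real.exp (2 * ‖β‖ / h) * A') + (4 * (1 + normSq x) ^ 2 +
        32 * (‖β‖ / h) ^ 2 * (1 + normSq x) ^ 2) * (‖u x‖ ^ 2 * W x) := by
        have h1 : 1 + ‖x‖ ^ 2 ≤ (1 + normSq x) ^ 2 := by nlinarith
        have h2 : ‖x‖ ^ 2 * (1 + ‖x‖ ^ 2) ≤ (1 + normSq x) ^ 2 := by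
          rw [sq (1 + normSq x)]
          gcongr
          linarith
        gcongr
    _ = _ := by ring

end Derivative

/-! ### Integration by parts -/

section Parts

theorem integral_eq_zero_of_hasLineDerivAt {G G' : (Fin n → ℂ) → ℂ} {v : Fin n → ℂ}
    (hG : Integrable G) (hG' : Integrable G') (hd : ∀ x, HasLineDerivAt ℝ G (G' x) x v) :
    ∫ x, G' x = 0 := by
  have := integral_bilinear_hasLineDerivAt_right_eq_neg_left_of_integrable (μ := volume)
    (f := fun _ : Fin n → ℂ => (1 : ℂ)) (f' := fun _ => 0) (g := G) (g' := G') (v := v)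
    (B := ContinuousLinearMap.mul ℝ ℂ) (by simp) (by simpa using hG') (by simpa using hG)
    (fun x _ => by simpa [HasLineDerivAt] using hasDerivAt_const (0 : ℝ) (1 : ℂ)) (fun x _ => hd x)
  simpa using this

theorem holGrad_bilin (β : (Fin n → ℂ) →L[ℝ] (Fin n → ℂ) →L[ℝ] ℝ) (x : Fin n → ℂ) (k : Fin n) :
    holGrad (fun x => β x x) x k = (1 / 2) *
      (((β x (Pi.single k 1) + β (Pi.single k 1) x : ℝ) : ℂ) - Complex.I *
        ((β x (Complex.I • Pi.single k 1) + β (Complex.I • Pi.single k 1) x : ℝ) : ℂ)) := by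
  have h1 : ∀ v, fderiv ℝ (fun x => β x x) x v = β x v + β v x := by
    intro v
    have h0 : HasFDerivAt (fun x => β x x) _ x :=
      β.hasFDerivAt_of_bilinear (hasFDerivAt_id x) (hasFDerivAt_id x)
    rw [h0.fderiv]
    simp
  have h2 : (Pi.single k Complex.I : Fin n → ℂ) = Complex.I • Pi.single k 1 := by
    rw [← Pi.single_smul]
    simp
  rw [holGrad, h1, h1, h2]

/-- Integration by parts in a quadratic weight: as `conj u` is antiholomorphic, `∂ₖ` falls only on
`xⱼ` and on the weight. -/
theorem integrable_and_integral_parts_eq_zero {h : ℝ} (hh : 0 < h)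
    (β : (Fin n → ℂ) →L[ℝ] (Fin n → ℂ) →L[ℝ] ℝ) {u : (Fin n → ℂ) → ℂ} (hu : Differentiable ℂ u)
    (hui : Integrable fun x => (1 + normSq x) ^ 2 * (‖u x‖ ^ 2 * Real.exp (-2 * β x x / h)))
    (j k : Fin n) (D : (Fin n → ℂ) → ℂ)
    (hD : ∀ x, D x = (x j * fderiv ℂ u x (Pi.single k 1)
      - 2 / h * (x j * holGrad (fun x => β x x) x k) * u x + (if j = k then 1 else 0) * u x) *
      starRingEnd ℂ (u x) * (Real.exp (-2 * β x x / h) : ℝ)) :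
    Integrable D ∧ ∫ x, D x = 0 := by
  set e : Fin n → ℂ := Pi.single k 1 with he
  have hen : ‖e‖ = 1 := by simp [he, Pi.norm_single]
  have huc := hu.continuous
  have hdi := integrable_norm_fderiv_sq hh β hu hui k
  rw [← he] at hdi
  have hdu : Continuous fun x => fderiv ℂ u x e := (differentiable_fderiv_apply hu e).continuous
  set W : (Fin n → ℂ) → ℝ := fun x => Real.exp (-2 * β x x / h) with hW
  have hWc : Continuous W := by fun_prop
  have hW0 : ∀ x, 0 ≤ W x := fun x => Real.exp_nonneg _
  have hcj : ∀ x : Fin n → ℂ, ‖x j‖ ≤ ‖x‖ := fun x => norm_le_pi_norm x j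
  set G : (Fin n → ℂ) → ℂ := fun x => x j * (u x * starRingEnd ℂ (u x)) * (W x : ℂ) with hG
  have hGi : Integrable G := by
    refine hui.mono' (Continuous.aestronglyMeasurable (by fun_prop))
      (Filter.Eventually.of_forall fun x => ?_)
    simp only [hG, norm_mul, RCLike.norm_conj, Complex.norm_real, Real.norm_of_nonneg (hW0 x)]
    have h1 : ‖x j‖ ≤ (1 + normSq x) ^ 2 := by
      nlinarith [hcj x, norm_sq_le_normSq x, normSq_nonneg x, sq_nonneg (‖x‖ - 1)]
    calc _ = ‖x j‖ * (‖u x‖ ^ 2 * W x) := by ring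
      _ ≤ _ := mul_le_mul_of_nonneg_right h1 (mul_nonneg (by positivity) (hW0 x))
  -- the derivative of `G` in a real direction `v` with `∂ᵥ u = c ∂ₖ u`
  have key : ∀ (c : ℂ), ‖c‖ = 1 →
      Integrable (fun x => ((c • e) j * (u x * starRingEnd ℂ (u x)) +
        x j * (c * fderiv ℂ u x e * starRingEnd ℂ (u x) +
          u x * starRingEnd ℂ (c * fderiv ℂ u x e)) +
        x j * (u x * starRingEnd ℂ (u x)) *
          ((-2 * (β x (c • e) + β (c • e) x) / h : ℝ) : ℂ)) * (W x : ℂ)) ∧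
      ∫ x, ((c • e) j * (u x * starRingEnd ℂ (u x)) +
        x j * (c * fderiv ℂ u x e * starRingEnd ℂ (u x) +
          u x * starRingEnd ℂ (c * fderiv ℂ u x e)) +
        x j * (u x * starRingEnd ℂ (u x)) *
          ((-2 * (β x (c • e) + β (c • e) x) / h : ℝ) : ℂ)) * (W x : ℂ) = 0 := by
    intro c hc
    have hce : ‖c • e‖ = 1 := by rw [norm_smul, hc, hen, one_mul]
    have hint : Integrable (fun x => ((c • e) j * (u x * starRingEnd ℂ (u x)) +
        x j * (c * fderiv ℂ u x e * starRingEnd ℂ (u x) +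
          u x * starRingEnd ℂ (c * fderiv ℂ u x e)) +
        x j * (u x * starRingEnd ℂ (u x)) *
          ((-2 * (β x (c • e) + β (c • e) x) / h : ℝ) : ℂ)) * (W x : ℂ)) := by
      refine (hdi.add (hui.const_mul (2 + 4 * (‖β‖ / h)))).mono'
        (Continuous.aestronglyMeasurable (by fun_prop)) (Filter.Eventually.of_forall fun x => ?_)
      rw [norm_mul, Complex.norm_real, Real.norm_of_nonneg (hW0 x), Pi.add_apply]
      have h1 : ‖(c • e) j * (u x * starRingEnd ℂ (u x))‖ ≤ ‖u x‖ ^ 2 := by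
        rw [norm_mul, norm_mul, RCLike.norm_conj, ← sq]
        have := hcj (c • e)
        rw [hce] at this
        exact mul_le_of_le_one_left (by positivity) this
      have h2 : ‖x j * (c * fderiv ℂ u x e * starRingEnd ℂ (u x) +
          u x * starRingEnd ℂ (c * fderiv ℂ u x e))‖ ≤
          ‖x‖ ^ 2 * ‖fderiv ℂ u x e‖ ^ 2 + ‖u x‖ ^ 2 := by
        rw [norm_mul]
        have h3 := norm_add_le (c * fderiv ℂ u x e * starRingEnd ℂ (u x))
          (u x * starRingEnd ℂ (c * fderiv ℂ u x e))
        simp only [norm_mul, RCLike.norm_conj, hc, one_mul] at h3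
        calc _ ≤ ‖x‖ * (‖fderiv ℂ u x e‖ * ‖u x‖ + ‖u x‖ * ‖fderiv ℂ u x e‖) :=
              mul_le_mul (hcj x) h3 (norm_nonneg _) (norm_nonneg _)
          _ ≤ _ := by nlinarith [sq_nonneg (‖x‖ * ‖fderiv ℂ u x e‖ - ‖u x‖)]
      have h4 : ‖x j * (u x * starRingEnd ℂ (u x)) *
          ((-2 * (β x (c • e) + β (c • e) x) / h : ℝ) : ℂ)‖ ≤
          4 * (‖β‖ / h) * ‖x‖ ^ 2 * ‖u x‖ ^ 2 := by
        have h5 := β.le_opNorm₂ x (c • e)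
        have h6 := β.le_opNorm₂ (c • e) x
        rw [hce, mul_one] at h5 h6
        have h7 : ‖-2 * (β x (c • e) + β (c • e) x) / h‖ ≤ 4 * (‖β‖ / h) * ‖x‖ := by
          rw [norm_div, Real.norm_of_nonneg hh.le, div_le_iff₀ hh, norm_mul]
          have := norm_add_le (β x (c • e)) (β (c • e) x)
          norm_num
          field_simp
          simp only [Real.norm_eq_abs] at this h5 h6
          linarith
        rw [norm_mul, norm_mul, norm_mul, RCLike.norm_conj, Complex.norm_real]
        calc _ ≤ ‖x‖ * (‖u x‖ * ‖u x‖) * (4 * (‖β‖ / h) * ‖x‖) := by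
              gcongr
              exact hcj x
          _ = _ := by ring
      have h8 := norm_sq_le_normSq x
      have h9 := normSq_nonneg x
      calc _ ≤ (‖u x‖ ^ 2 + (‖x‖ ^ 2 * ‖fderiv ℂ u x e‖ ^ 2 + ‖u x‖ ^ 2) +
            4 * (‖β‖ / h) * ‖x‖ ^ 2 * ‖u x‖ ^ 2) * W x :=
            mul_le_mul_of_nonneg_right (norm_add₃_le.trans (by gcongr)) (hW0 x)
        _ = ‖x‖ ^ 2 * (‖fderiv ℂ u x e‖ ^ 2 * W x) +
            (2 * 1 + 4 * (‖β‖ / h) * ‖x‖ ^ 2) * (‖u x‖ ^ 2 * W x) := by ring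
        _ ≤ (1 + ‖x‖ ^ 2) * (‖fderiv ℂ u x e‖ ^ 2 * W x) +
            (2 * (1 + normSq x) ^ 2 + 4 * (‖β‖ / h) * (1 + normSq x) ^ 2) *
              (‖u x‖ ^ 2 * W x) := by
            have := hW0 x
            gcongr
            · linarith
            · nlinarith
            · nlinarith
        _ = _ := by ring
    refine ⟨hint, integral_eq_zero_of_hasLineDerivAt (v := c • e) hGi hint fun x => ?_⟩
    have hx : HasDerivAt (fun t : ℝ => x + t • (c • e)) (c • e) 0 := by
      simpa using ((hasDerivAt_id (0 : ℝ)).smul_const (c • e)).const_add x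
    have hud : HasDerivAt (fun t : ℝ => u (x + t • (c • e))) (c * fderiv ℂ u x e) 0 := by
      have h1 : HasFDerivAt u ((fderiv ℂ u x).restrictScalars ℝ) (x + (0 : ℝ) • (c • e)) := by
        simpa using (hu x).hasFDerivAt.restrictScalars ℝ
      exact (h1.comp_hasDerivAt 0 hx).congr_deriv (by simp)
    have hxj : HasDerivAt (fun t : ℝ => (x + t • (c • e)) j) ((c • e) j) 0 :=
      (hasDerivAt_pi.mp hx) j
    have hWd : HasDerivAt (fun t : ℝ => (W (x + t • (c • e)) : ℂ))
        ((W x * (-2 * (β x (c • e) + β (c • e) x) / h) : ℝ) : ℂ) 0 := by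
      have h1 := β.hasFDerivAt_of_bilinear (hasFDerivAt_id (x + (0 : ℝ) • (c • e)))
        (hasFDerivAt_id (x + (0 : ℝ) • (c • e)))
      have h2 := (((h1.comp_hasDerivAt 0 hx).const_mul (-2)).div_const h).exp
      simpa [hW] using h2.ofReal_comp
    have h3 := (hxj.mul (hud.mul hud.star)).mul hWd
    unfold HasLineDerivAt
    refine h3.congr_deriv ?_
    simp only [zero_smul, add_zero, Pi.mul_apply, Complex.star_def]
    push_cast
    ring
  obtain ⟨hi1, hz1⟩ := key 1 norm_one
  obtain ⟨hi2, hz2⟩ := key Complex.I Complex.norm_I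
  have hcomb := (hi1.sub (hi2.const_mul Complex.I)).const_mul (1 / 2)
  have hD' : D = fun x => (1 / 2 : ℂ) * (((((1 : ℂ) • e) j * (u x * starRingEnd ℂ (u x)) +
        x j * (1 * fderiv ℂ u x e * starRingEnd ℂ (u x) +
          u x * starRingEnd ℂ (1 * fderiv ℂ u x e)) +
        x j * (u x * starRingEnd ℂ (u x)) *
          ((-2 * (β x ((1 : ℂ) • e) + β ((1 : ℂ) • e) x) / h : ℝ) : ℂ)) * (W x : ℂ)) -
      Complex.I * (((Complex.I • e) j * (u x * starRingEnd ℂ (u x)) +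
        x j * (Complex.I * fderiv ℂ u x e * starRingEnd ℂ (u x) +
          u x * starRingEnd ℂ (Complex.I * fderiv ℂ u x e)) +
        x j * (u x * starRingEnd ℂ (u x)) *
          ((-2 * (β x (Complex.I • e) + β (Complex.I • e) x) / h : ℝ) : ℂ)) * (W x : ℂ))) := by
    funext x
    rw [hD, holGrad_bilin, ← he, show Real.exp (-2 * β x x / h) = W x from rfl]
    have hej : e j = if j = k then 1 else 0 := by simp [he, Pi.single_apply]
    have hI : Complex.I * Complex.I = -1 := Complex.I_mul_I
    rw [← hej]
    simp only [one_smul, one_mul, map_mul, Complex.conj_I, Pi.smul_apply, smul_eq_mul]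
    push_cast
    linear_combination (1 / 2 : ℂ) * (e j * u x * starRingEnd ℂ (u x) * W x +
      x j * (fderiv ℂ u x e * starRingEnd ℂ (u x) -
      u x * starRingEnd ℂ (fderiv ℂ u x e)) * W x) * hI
  rw [hD']
  refine ⟨hcomb, ?_⟩
  rw [integral_const_mul, integral_sub hi1 (hi2.const_mul _), integral_const_mul, hz1, hz2]
  simp

end Parts

/-! ### The Weyl quantization of `Mx · ξ` -/

section Weyl

/-- A quadratic form vanishing for `x = 0` and for `ξ = 0` is `Mx · ξ`. -/
theorem apply_eq_sum_of_vanishing (Q : QuadraticForm ℂ (Phase n)) (h1 : ∀ x, Q (x, 0) = 0)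
    (h2 : ∀ ξ, Q (0, ξ) = 0) (x ξ : Fin n → ℂ) :
    Q (x, ξ) = ∑ j, ∑ k, 2 * polarization Q (ex j) (eξ k) * (x j * ξ k) := by
  have hx : ((x, 0) : Phase n) = ∑ j, x j • ex j := by
    ext i
    · simp [ex, Prod.fst_sum, Finset.sum_apply, Pi.single_apply]
    · simp [ex, Prod.snd_sum]
  have hξ : ((0, ξ) : Phase n) = ∑ k, ξ k • eξ k := by
    ext i
    · simp [eξ, Prod.fst_sum]
    · simp [eξ, Prod.snd_sum, Finset.sum_apply, Pi.single_apply]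
  have h3 : Q (x, ξ) = 2 * polarization Q (x, 0) (0, ξ) := by
    simp [polarization, QuadraticMap.associated_apply, h1, h2]
  rw [h3, hx, hξ]
  simp only [map_sum, map_smul, LinearMap.smul_apply, LinearMap.coe_sum, Finset.sum_apply,
    smul_eq_mul, Finset.mul_sum]
  refine (Finset.sum_comm).trans ?_
  refine Finset.sum_congr rfl fun j _ => Finset.sum_congr rfl fun k _ => by ring

/-- The Weyl quantization of `Mx · ξ` is a first order operator. -/
theorem weyl_eq_of_vanishing (h : ℝ) (Q : QuadraticForm ℂ (Phase n)) (h1 : ∀ x, Q (x, 0) = 0)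
    (h2 : ∀ ξ, Q (0, ξ) = 0) {u : (Fin n → ℂ) → ℂ} (hu : Differentiable ℂ u) (x : Fin n → ℂ) :
    weyl h Q u x = ∑ j, ∑ k, h / Complex.I * polarization Q (ex j) (eξ k) *
      (2 * (x j * fderiv ℂ u x (Pi.single k 1)) + (if j = k then 1 else 0) * u x) := by
  unfold weyl
  refine Finset.sum_congr rfl fun j _ => Finset.sum_congr rfl fun k _ => ?_
  have hxx : polarization Q (ex j) (ex k) = 0 :=
    polarization_eq_zero_of_apply_eq_zero Q (h1 _) (h1 _) (by simpa [ex] using h1 _)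
  have hξξ : polarization Q (eξ j) (eξ k) = 0 :=
    polarization_eq_zero_of_apply_eq_zero Q (h2 _) (h2 _) (by simpa [eξ] using h2 _)
  have hd : fderiv ℂ (fun y : Fin n → ℂ => y j * u y) x (Pi.single k 1) =
      x j * fderiv ℂ u x (Pi.single k 1) + (if j = k then 1 else 0) * u x := by
    have h3 : HasFDerivAt (fun y : Fin n → ℂ => y j) (ContinuousLinearMap.proj (R := ℂ) j) x :=
      hasFDerivAt_apply j x
    have h4 : HasFDerivAt (fun y : Fin n → ℂ => y j * u y) _ x := h3.mul (hu x).hasFDerivAt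
    rw [h4.fderiv]
    simp [Pi.single_apply, mul_comm]
  simp only [hxx, hξξ, hD, hd]
  ring

end Weyl

/-! ### The a priori estimate -/

section Energy

variable {h : ℝ} {β : (Fin n → ℂ) →L[ℝ] (Fin n → ℂ) →L[ℝ] ℝ} {u : (Fin n → ℂ) → ℂ}

/-- `q̃ʷ - z` maps the functions `u ∈ H_Φ` with `(1 + |x|²) u ∈ L²_Φ` to `H_Φ`. -/
theorem memH_weyl_sub (hh : 0 < h) (hu : Differentiable ℂ u)
    (hum : MemL2 h (fun x => β x x) u)
    (hui : Integrable fun x => (1 + normSq x) ^ 2 * (‖u x‖ ^ 2 * Real.exp (-2 * β x x / h)))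
    {Q : QuadraticForm ℂ (Phase n)} (h1 : ∀ x, Q (x, 0) = 0) (h2 : ∀ ξ, Q (0, ξ) = 0) (z : ℂ) :
    MemH h (fun x => β x x) fun x => weyl h Q u x - z * u x := by
  have hdu : ∀ e, Differentiable ℂ fun x => fderiv ℂ u x e := differentiable_fderiv_apply hu
  have hT : ∀ j k, MemL2 h (fun x => β x x) fun x => x j * fderiv ℂ u x (Pi.single k 1) := by
    intro j k
    have hduc := (hdu (Pi.single k 1)).continuous
    have huc := hu.continuous
    rw [memL2_iff_integrable (by fun_prop) (by fun_prop)]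
    refine (integrable_norm_fderiv_sq hh β hu hui k).mono'
      (Continuous.aestronglyMeasurable (by fun_prop)) (Filter.Eventually.of_forall fun x => ?_)
    rw [Real.norm_of_nonneg (by positivity), norm_mul, mul_pow, mul_assoc]
    gcongr
    have := norm_le_pi_norm x j
    nlinarith [norm_nonneg (x j)]
  have hterm : ∀ j k, MemH h (fun x => β x x) fun x => h / Complex.I *
      polarization Q (ex j) (eξ k) *
      (2 * (x j * fderiv ℂ u x (Pi.single k 1)) + (if j = k then 1 else 0) * u x) := by
    intro j k
    have hduk := hdu (Pi.single k 1)
    refine ⟨?_, (((hT j k).const_mul 2).add (hum.const_mul _)).const_mul _⟩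
    exact (((((differentiable_apply j).mul hduk).const_mul 2)).add (hu.const_mul _)).const_mul _
  simp only [weyl_eq_of_vanishing h Q h1 h2 hu]
  generalize hF : (fun j k x => h / Complex.I * polarization Q (ex j) (eξ k) *
      (2 * (x j * fderiv ℂ u x (Pi.single k 1)) + (if j = k then 1 else 0) * u x) :
      Fin n → Fin n → (Fin n → ℂ) → ℂ) = F
  have hterm' : ∀ j k, MemH h (fun x => β x x) (F j k) := by
    rw [← hF]
    exact hterm
  have hgoal : MemH h (fun x => β x x) fun x => (∑ j, ∑ k, F j k x) - z * u x := by
    refine ⟨(Differentiable.fun_sum fun j _ => Differentiable.fun_sum fun k _ =>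
      (hterm' j k).1).sub (hu.const_mul z), MemLp.sub ?_ (MemLp.const_mul hum z)⟩
    exact memLp_finsetSum _ fun j _ => memLp_finsetSum _ fun k _ => (hterm' j k).2
  rw [← hF] at hgoal
  exact hgoal

/-- On the graph `ξ = (2/i) ∂Φ/∂x` the symbol `q̃` gives the operator `q̃ʷ` in the mean, up to the
constant `(h/i) tr M / 2`. -/
theorem integral_weyl_mul_conj (hh : 0 < h) (hu : Differentiable ℂ u)
    (hui : Integrable fun x => (1 + normSq x) ^ 2 * (‖u x‖ ^ 2 * Real.exp (-2 * β x x / h)))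
    {Q : QuadraticForm ℂ (Phase n)} (h1 : ∀ x, Q (x, 0) = 0) (h2 : ∀ ξ, Q (0, ξ) = 0) (z : ℂ) :
    ∃ E : (Fin n → ℂ) → ℂ, Integrable E ∧ ∫ x, E x = 0 ∧ ∀ x,
      (weyl h Q u x - z * u x) * starRingEnd ℂ (u x) * (Real.exp (-2 * β x x / h) : ℝ) =
      (Q (x, (2 / Complex.I) • holGrad (fun x => β x x) x) -
        h / Complex.I * (∑ j, polarization Q (ex j) (eξ j)) - z) *
        ((‖u x‖ ^ 2 * Real.exp (-2 * β x x / h) : ℝ) : ℂ) + E x := by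
  let D : Fin n → Fin n → (Fin n → ℂ) → ℂ := fun j k x =>
    (x j * fderiv ℂ u x (Pi.single k 1) - 2 / h * (x j * holGrad (fun x => β x x) x k) * u x +
      (if j = k then 1 else 0) * u x) * starRingEnd ℂ (u x) * (Real.exp (-2 * β x x / h) : ℝ)
  have hDp := fun j k =>
    integrable_and_integral_parts_eq_zero hh β hu hui j k (D j k) fun _ => rfl
  refine ⟨fun x => ∑ j, ∑ k, 2 * (h / Complex.I) * polarization Q (ex j) (eξ k) * D j k x,
    integrable_finsetSum _ fun j _ => integrable_finsetSum _ fun k _ =>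
      (hDp j k).1.const_mul _, ?_, fun x => ?_⟩
  · rw [integral_finsetSum _ fun j _ => integrable_finsetSum _ fun k _ =>
      (hDp j k).1.const_mul _]
    refine Finset.sum_eq_zero fun j _ => ?_
    rw [integral_finsetSum _ fun k _ => (hDp j k).1.const_mul _]
    refine Finset.sum_eq_zero fun k _ => ?_
    rw [integral_const_mul, (hDp j k).2, mul_zero]
  · have htr : ∑ j, polarization Q (ex j) (eξ j) =
        ∑ j, ∑ k, polarization Q (ex j) (eξ k) * (if j = k then 1 else 0) := by simp
    have hcu : ((‖u x‖ ^ 2 * Real.exp (-2 * β x x / h) : ℝ) : ℂ) =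
        u x * starRingEnd ℂ (u x) * (Real.exp (-2 * β x x / h) : ℝ) := by
      rw [Complex.mul_conj']
      push_cast
      rfl
    have hh' : (h : ℂ) ≠ 0 := by exact_mod_cast hh.ne'
    rw [hcu, weyl_eq_of_vanishing h Q h1 h2 hu, apply_eq_sum_of_vanishing Q h1 h2, htr]
    simp only [D]
    generalize ((Real.exp (-2 * β x x / h) : ℝ) : ℂ) = w
    have hsum : (∑ j, ∑ k, h / Complex.I * polarization Q (ex j) (eξ k) *
        (2 * (x j * fderiv ℂ u x (Pi.single k 1)) + (if j = k then 1 else 0) * u x)) *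
          (starRingEnd ℂ (u x) * w) =
        (∑ j, ∑ k, 2 * polarization Q (ex j) (eξ k) *
          (x j * ((2 / Complex.I) • holGrad (fun x => β x x) x) k) - h / Complex.I *
          ∑ j, ∑ k, polarization Q (ex j) (eξ k) * (if j = k then 1 else 0)) *
          (u x * starRingEnd ℂ (u x) * w) +
        ∑ j, ∑ k, 2 * (h / Complex.I) * polarization Q (ex j) (eξ k) *
          ((x j * fderiv ℂ u x (Pi.single k 1) - 2 / h * (x j * holGrad (fun x => β x x) x k) * u x
            + (if j = k then 1 else 0) * u x) * starRingEnd ℂ (u x) * w) := by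
      simp only [Finset.mul_sum, ← Finset.sum_sub_distrib, Finset.sum_mul,
        ← Finset.sum_add_distrib]
      refine Finset.sum_congr rfl fun j _ => Finset.sum_congr rfl fun k _ => ?_
      rw [Pi.smul_apply, smul_eq_mul]
      have hI := Complex.I_ne_zero
      field_simp
      ring
    linear_combination hsum

/-- The ellipticity of `q̃` in the region `|x| ≥ K`, together with the bound on the mass in
`|x| ≤ K`, gives the a priori estimate. -/
theorem normH_le_of_elliptic (hh : 0 < h) (hu : Differentiable ℂ u)
    (hum : MemL2 h (fun x => β x x) u)
    (hui : Integrable fun x => (1 + normSq x) ^ 2 * (‖u x‖ ^ 2 * Real.exp (-2 * β x x / h)))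
    {Q : QuadraticForm ℂ (Phase n)} (h1 : ∀ x, Q (x, 0) = 0) (h2 : ∀ ξ, Q (0, ξ) = 0)
    {C₀ K : ℝ} (hC₀ : 0 < C₀) (hK : 0 < K)
    (hell : ∀ x, normSq x / C₀ ≤ (Q (x, (2 / Complex.I) • holGrad (fun x => β x x) x)).re)
    (htr : h * ‖∑ j, polarization Q (ex j) (eξ j)‖ ≤ K ^ 2 / (8 * C₀))
    {z : ℂ} (hz : ‖z‖ ≤ K ^ 2 / (8 * C₀))
    (hhalf : ∫ x in {x | normSq x ≤ K ^ 2}, ‖u x‖ ^ 2 * Real.exp (-2 * β x x / h) ≤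
      (1 / 2) * ∫ x, ‖u x‖ ^ 2 * Real.exp (-2 * β x x / h)) :
    normH h (fun x => β x x) u ≤
      4 * C₀ / K ^ 2 * normH h (fun x => β x x) fun x => weyl h Q u x - z * u x := by
  have hΦc : Continuous fun x => β x x := by fun_prop
  obtain ⟨hPd, hPm⟩ := memH_weyl_sub hh hu hum hui h1 h2 z
  obtain ⟨E, hEi, hE0, hE⟩ := integral_weyl_mul_conj hh hu hui h1 h2 z
  have huc := hu.continuous
  have hPc := hPd.continuous
  have hU := (memL2_iff_integrable hΦc huc).mp hum
  have hPi := (memL2_iff_integrable hΦc hPc).mp hPm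
  have hB : MeasurableSet {x : Fin n → ℂ | normSq x ≤ K ^ 2} :=
    measurableSet_le continuous_normSq.measurable measurable_const
  set P : (Fin n → ℂ) → ℂ := fun x => weyl h Q u x - z * u x with hP
  set U : (Fin n → ℂ) → ℝ := fun x => ‖u x‖ ^ 2 * Real.exp (-2 * β x x / h) with hUdef
  set t := ∑ j, polarization Q (ex j) (eξ j) with ht
  set d : ℝ := K ^ 2 / (4 * C₀) with hd
  have hd0 : 0 < d := by positivity
  have hU0 : ∀ x, 0 ≤ U x := fun x => by positivity
  have hpt : ∀ x, 4 * d * (U x - {x | normSq x ≤ K ^ 2}.indicator U x) - d * U x + (E x).re ≤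
      (2 * d)⁻¹ * (‖P x‖ ^ 2 * Real.exp (-2 * β x x / h)) + d / 2 * U x := by
    intro x
    have h3 := congrArg Complex.re (hE x)
    rw [Complex.add_re, Complex.re_mul_ofReal, Complex.re_mul_ofReal] at h3
    have h4 : (P x * starRingEnd ℂ (u x)).re * Real.exp (-2 * β x x / h) ≤
        (2 * d)⁻¹ * (‖P x‖ ^ 2 * Real.exp (-2 * β x x / h)) + d / 2 * U x := by
      have h5 : (P x * starRingEnd ℂ (u x)).re ≤ ‖P x‖ * ‖u x‖ := by
        refine (Complex.re_le_norm _).trans ?_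
        rw [norm_mul, RCLike.norm_conj]
      have h6 : ‖P x‖ * ‖u x‖ ≤ (2 * d)⁻¹ * ‖P x‖ ^ 2 + d / 2 * ‖u x‖ ^ 2 := by
        have : (2 * d)⁻¹ * ‖P x‖ ^ 2 + d / 2 * ‖u x‖ ^ 2 - ‖P x‖ * ‖u x‖ =
            (2 * d)⁻¹ * (‖P x‖ - d * ‖u x‖) ^ 2 := by
          field_simp
          ring
        have : 0 ≤ (2 * d)⁻¹ * (‖P x‖ - d * ‖u x‖) ^ 2 := by positivity
        linarith
      calc _ ≤ ((2 * d)⁻¹ * ‖P x‖ ^ 2 + d / 2 * ‖u x‖ ^ 2) * Real.exp (-2 * β x x / h) :=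
            mul_le_mul_of_nonneg_right (h5.trans h6) (Real.exp_nonneg _)
        _ = _ := by
            rw [hUdef]
            ring
    have h7 : 4 * d * (U x - {x | normSq x ≤ K ^ 2}.indicator U x) - d * U x ≤
        (Q (x, (2 / Complex.I) • holGrad (fun x => β x x) x) - h / Complex.I * t - z).re * U x := by
      have h8 : -(h * ‖t‖) ≤ -(h / Complex.I * t).re := by
        have := Complex.re_le_norm (h / Complex.I * t)
        rw [norm_mul, norm_div, Complex.norm_I, div_one, Complex.norm_real,
          Real.norm_of_nonneg hh.le] at this
        linarith
      have h9 := Complex.re_le_norm z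
      have h10 : normSq x / C₀ - d ≤
          (Q (x, (2 / Complex.I) • holGrad (fun x => β x x) x) - h / Complex.I * t - z).re := by
        have h11 : d = K ^ 2 / (8 * C₀) + K ^ 2 / (8 * C₀) := by
          rw [hd]
          field_simp
          norm_num
        rw [Complex.sub_re, Complex.sub_re]
        linarith [hell x]
      refine le_trans ?_ (mul_le_mul_of_nonneg_right h10 (hU0 x))
      by_cases hx : normSq x ≤ K ^ 2
      · rw [Set.indicator_of_mem (by exact hx)]
        have := mul_nonneg (div_nonneg (normSq_nonneg x) hC₀.le) (hU0 x)
        linarith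
      · rw [Set.indicator_of_notMem (by exact hx)]
        have h12 : 4 * d ≤ normSq x / C₀ := by
          rw [hd, le_div_iff₀ hC₀]
          field_simp
          linarith
        nlinarith [hU0 x]
    linarith
  have hint := integral_mono
    ((((hU.sub (hU.indicator hB)).const_mul (4 * d)).sub (hU.const_mul d)).add hEi.re)
    ((hPi.const_mul (2 * d)⁻¹).add (hU.const_mul (d / 2))) hpt
  have hEre : ∫ x, RCLike.re (E x) = 0 := by
    rw [integral_re hEi, hE0]
    simp
  rw [integral_add' (((hU.sub (hU.indicator hB)).const_mul (4 * d)).sub (hU.const_mul d)) hEi.re,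
    integral_sub' ((hU.sub (hU.indicator hB)).const_mul (4 * d)) (hU.const_mul d),
    integral_const_mul, integral_sub' hU (hU.indicator hB), integral_const_mul,
    integral_indicator hB, integral_add' (hPi.const_mul _) (hU.const_mul _), integral_const_mul,
    integral_const_mul, hEre] at hint
  have hnP : normH h (fun x => β x x) P ^ 2 =
      ∫ x, ‖weyl h Q u x - z * u x‖ ^ 2 * Real.exp (-2 * β x x / h) :=
    normH_sq_eq_integral hΦc hPm
  have hnu : normH h (fun x => β x x) u ^ 2 = ∫ x, U x := normH_sq_eq_integral hΦc hum
  rw [← hnP, ← hnu] at hint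
  rw [← hnu] at hhalf
  have hfin : (d * normH h (fun x => β x x) u) ^ 2 ≤ normH h (fun x => β x x) P ^ 2 := by
    have h3 : d * normH h (fun x => β x x) u ^ 2 ≤
        (2 * d)⁻¹ * normH h (fun x => β x x) P ^ 2 +
          d / 2 * normH h (fun x => β x x) u ^ 2 := by
      have := mul_le_mul_of_nonneg_left hhalf (by positivity : 0 ≤ 4 * d)
      linarith
    have h4 : d / 2 * normH h (fun x => β x x) u ^ 2 ≤
        (2 * d)⁻¹ * normH h (fun x => β x x) P ^ 2 := by linarith
    rw [inv_mul_eq_div, le_div_iff₀ (by positivity)] at h4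
    linarith
  have h3 : d * normH h (fun x => β x x) u ≤ normH h (fun x => β x x) P :=
    (sq_le_sq₀ (mul_nonneg hd0.le ENNReal.toReal_nonneg)
      ENNReal.toReal_nonneg).mp hfin
  have h4 : 4 * C₀ / K ^ 2 = d⁻¹ := by
    rw [hd, inv_div]
  rw [h4, inv_mul_eq_div, le_div_iff₀ hd0]
  linarith

end Energy

end QuadBargmann



theorem proposition3p2 {n : ℕ} (q : QuadraticForm ℂ (Phase n)) (hq : RePosDef q)
    -- a real canonical transformation taking `Λ⁻` to `η = -iy` and `Λ⁺` to `η = Ay`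
    (S : Phase n ≃ₗ[ℂ] Phase n) (hS : IsRealCanonical S)
    (hminus : ∀ Y : Phase n, Y ∈ (lambdaMinus q).map (S : Phase n →ₗ[ℂ] Phase n) ↔
      Y.2 = -Complex.I • Y.1)
    (A : Matrix (Fin n) (Fin n) ℂ)
    (hplus : ∀ Y : Phase n, Y ∈ (lambdaPlus q).map (S : Phase n →ₗ[ℂ] Phase n) ↔
      Y.2 = A *ᵥ Y.1)
    (C : GL (Fin n) ℂ)
    (K : ℝ) (hK : 0 < K)
    (C₁ : ℝ) (hC₁ : 1 ≤ C₁) (hΦ : ∀ x, Phi1 A C x ≤ C₁ * normSq x)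
    (C₀ : ℝ) (hC₀ : 1 < C₀)
    (hell : ∀ x, normSq x / C₀ ≤
      (qTilde q S A C (x, (2 / Complex.I) • holGrad (Phi1 A C) x)).re) :
    ∃ c : ℝ, 0 < c ∧ ∃ h₀ : ℝ, 0 < h₀ ∧ ∀ h : ℝ, 0 < h → h ≤ h₀ →
      ∀ z : ℂ, ‖z‖ ≤ K ^ 2 / (8 * C₀) →
      ∀ u : (Fin n → ℂ) → ℂ, MemH h (Phi1 A C) u →
        MemL2 h (Phi1 A C) (fun x => ((1 + normSq x : ℝ) : ℂ) * u x) →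
        VanishesToOrder ⌈(2 * C₁ * (K + 1) ^ 2 * Real.exp 1 ^ 2 + 1) / h⌉₊ u →
        MemH h (Phi1 A C) (fun x => weyl h (qTilde q S A C) u x - z * u x) ∧
        normH h (Phi1 A C) u ≤
          c * normH h (Phi1 A C) (fun x => weyl h (qTilde q S A C) u x - z * u x) := by
  have hQ0 : ∀ ξ, qTilde q S A C (0, ξ) = 0 := qTilde_zero_left C hminus
  have hQ1 : ∀ x, qTilde q S A C (x, 0) = 0 := qTilde_zero_right C hminus hplus
  have hΦ' : ∀ x, -(C₁ * normSq x) ≤ Phi1 A C x := neg_le_Phi1 hΦ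
  obtain ⟨β, hβ⟩ := exists_bilin_Phi1 A C
  generalize qTilde q S A C = Q at *
  simp only [hβ] at hΦ hΦ' hell ⊢
  set t := ∑ j, polarization Q (ex j) (eξ j) with ht
  have hC₀' : 0 < C₀ := by linarith
  refine ⟨4 * C₀ / K ^ 2, by positivity, min 1 (K ^ 2 / (8 * C₀) / (‖t‖ + 1)), by positivity,
    fun h hh hh0 z hz u hu hu2 hN => ?_⟩
  have hΦc : Continuous fun x => β x x := by fun_prop
  have huc := hu.1.continuous
  have hnsc : Continuous (normSq : (Fin n → ℂ) → ℝ) := continuous_normSq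
  have hui : Integrable fun x => (1 + normSq x) ^ 2 * (‖u x‖ ^ 2 * Real.exp (-2 * β x x / h)) := by
    refine ((memL2_iff_integrable hΦc (by fun_prop)).mp hu2).congr
      (Filter.Eventually.of_forall fun x => ?_)
    simp only [norm_mul, Complex.norm_real, mul_pow, Real.norm_eq_abs, sq_abs, mul_assoc]
  have htr : h * ‖t‖ ≤ K ^ 2 / (8 * C₀) := by
    have h1 := hh0.trans (min_le_right _ _)
    rw [le_div_iff₀ (by positivity)] at h1
    linarith
  exact ⟨memH_weyl_sub hh hu.1 hu.2 hui hQ1 hQ0 z,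
    normH_le_of_elliptic hh hu.1 hu.2 hui hQ1 hQ0 hC₀' hK hell htr hz
      (setIntegral_le_half hh (hh0.trans (min_le_left _ _)) hΦc hC₁ hΦ hΦ' hK hu.1 hN
        ((memL2_iff_integrable hΦc huc).mp hu.2))⟩
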